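/- Let $d\ge 2$, let $z_1,\dots,z_d>0$ be even integers, and let $b_1,\dots,b_{d-1}\ge 0$ be integers each of which is odd or $0$; put $b_d=0$. For integers $y,c$ let $\eta(y,c)=1$ if $y>c$ and $\eta(y,c)=0$ otherwise. For $1\le k\le d$ let $$\alpha_k=z_d\prod_{j=0}^{k-2}\frac{z_{j+1}}{2},\qquad \eta_{\alpha_k}=\eta\Big(z_d(b_k+1)\prod_{j=0}^{k-2}\frac{z_{j+1}}{2},\ \alpha_k\Big),$$ and let $A_2=\eta\big(z_d(b_1+1)+1,\alpha_2\big)$, $$A_3=(2(b_1+1))^{1-A_2}\,z_1^{A_2},\qquad A_k=(b_{k-2}+1)^{(1-\eta_{\alpha_{k-1}})\eta_{\alpha_{k-2}}}\Big(\frac{z_{k-2}}{2}\Big)^{\eta_{\alpha_{k-1}}}\quad (4\le k\le d+1).$$ Assume that $4\mid z_d$, that $A_3\mid z_1$, and that $2A_{k+1}\mid z_{k-1}$ for all $3\le k\le d$. Then the torus $$C_{z_1}\,\square\, C_{z_d}\,\square\, C_{z_2}\,\square\, C_{z_3}\,\square\cdots\square\, C_{z_{d-1}}$$ (which is $C_{z_1}\square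 C_{z_2}$ for $d=2$ and $C_{z_1}\square C_{z_3}\square C_{z_2}$ for $d=3$) is the union of $$2\prod_{k=0}^{d-2}\frac{z_{k+1}}{A_{k+3}}$$ pairwise edge-disjoint subgraphs, each of which is a cycle of length $\frac{d z_d}{2}\prod_{k=0}^{d-2}A_{k+3}$ containing exactly $\frac{z_d}{2}\prod_{k=0}^{d-2}A_{k+3}$ edges from each of the $d$ dimensions (factors) of the torus. Here $C_n$ denotes the cycle of length $n\ge 2$; $C_2$ has two vertices joined by two parallel edges. -/

import Mathlib

namespace LockKey

open scoped Graph

/-- The torus `C_{n 0} □ C_{n 1} □ ⋯ □ C_{n (d-1)}` as a (multi)graph. The vertices are the tuples in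
`ℤ/n 0 × ⋯ × ℤ/n (d-1)`; for every vertex `x` and every dimension `i` there is an edge `(x, i)`,
coming from the factor `C_{n i}`, that joins `x` to the vertex obtained from `x` by adding `1` to
coordinate `i`. For `n i ≥ 3` this is the usual simple graph; the cycle `C_2` of length two has
two parallel edges. -/
def torus {d : ℕ} (n : Fin d → ℕ) :
    Graph (∀ i, ZMod (n i)) ((∀ i, ZMod (n i)) × Fin d) where
  vertexSet := Set.univ
  IsLink e x y :=
    (x = e.1 ∧ y = Function.update e.1 e.2 (e.1 e.2 + 1)) ∨
      (y = e.1 ∧ x = Function.update e.1 e.2 (e.1 e.2 + 1))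
  edgeSet := Set.univ
  isLink_symm := fun _ _ => ⟨fun _ _ h => h.symm⟩
  eq_or_eq_of_isLink_of_isLink := by
    rintro e x y v w (⟨rfl, rfl⟩ | ⟨rfl, rfl⟩) (⟨rfl, rfl⟩ | ⟨rfl, rfl⟩) <;> simp
  edge_mem_iff_exists_isLink := fun e =>
    ⟨fun _ => ⟨_, _, Or.inl ⟨rfl, rfl⟩⟩, fun _ => Set.mem_univ e⟩
  left_mem_of_isLink := fun _ _ _ _ => Set.mem_univ _

/-- The graph `H` is a cycle of length `L ≥ 2`: its vertices are `v 0, …, v (L-1)`, pairwise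
distinct, its edges are `e 0, …, e (L-1)`, pairwise distinct, and `e k` joins `v k` to `v (k+1)`,
indices being taken modulo `L`. -/
def IsCycleOfLength {α β : Type*} (H : Graph α β) (L : ℕ) : Prop :=
  2 ≤ L ∧ ∃ (v : ZMod L → α) (e : ZMod L → β),
    Function.Injective v ∧ Function.Injective e ∧
    V(H) = Set.range v ∧ E(H) = Set.range e ∧
    ∀ k, H.IsLink (e k) (v k) (v (k + 1))

/-- The family `H` of subgraphs of `G` is a decomposition of `G`: the union of the `H j` is `G`,
and the `H j` are pairwise edge-disjoint. -/
structure IsDecomposition {α β κ : Type*} (G : Graph α β) (H : κ → Graph α β) : Prop where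
  le : ∀ j, H j ≤ G
  vertexSet_eq : V(G) = ⋃ j, V(H j)
  edgeSet_eq : E(G) = ⋃ j, E(H j)
  disjoint : ∀ j j', j ≠ j' → Disjoint E(H j) E(H j')

/-- `η(y, c) = 1` if `y > c`, and `0` otherwise. -/
def eta (y c : ℕ) : ℕ := if c < y then 1 else 0

/-- `α_k = z_d ∏_{j=0}^{k-2} z_{j+1} / 2`. -/
def alphaMax (z : ℕ → ℕ) (d k : ℕ) : ℕ := z d * ∏ j ∈ Finset.range (k - 1), z (j + 1) / 2

/-- `η_{α_k} = η(z_d (b_k + 1) ∏_{j=0}^{k-2} z_{j+1} / 2, α_k)`, with the convention `b_d = 0`. -/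
def etaAlpha (z b : ℕ → ℕ) (d k : ℕ) : ℕ :=
  eta (z d * ((if k = d then 0 else b k) + 1) * ∏ j ∈ Finset.range (k - 1), z (j + 1) / 2)
    (alphaMax z d k)

/-- `A_2 = η(z_d (b_1 + 1) + 1, α_2)`. -/
def A₂ (z b : ℕ → ℕ) (d : ℕ) : ℕ := eta (z d * (b 1 + 1) + 1) (alphaMax z d 2)

/-- The numbers `A_k` for `3 ≤ k ≤ d + 1`: `A_3 = (2 (b_1 + 1))^{1 - A_2} z_1^{A_2}`, and
`A_k = (b_{k-2} + 1)^{(1 - η_{α_{k-1}}) η_{α_{k-2}}} (z_{k-2} / 2)^{η_{α_{k-1}}}` for `k ≥ 4`. -/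
def A (z b : ℕ → ℕ) (d k : ℕ) : ℕ :=
  if k = 3 then (2 * (b 1 + 1)) ^ (1 - A₂ z b d) * z 1 ^ A₂ z b d
  else (b (k - 2) + 1) ^ ((1 - etaAlpha z b d (k - 1)) * etaAlpha z b d (k - 2)) *
    (z (k - 2) / 2) ^ etaAlpha z b d (k - 1)

/-- The lengths of the factors of `C_{z_1} □ C_{z_d} □ C_{z_2} □ C_{z_3} □ ⋯ □ C_{z_{d-1}}`, in this
order. -/
def factorLength (z : ℕ → ℕ) (d : ℕ) (i : Fin d) : ℕ :=
  if (i : ℕ) = 0 then z 1 else if (i : ℕ) = 1 then z d else z i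

end LockKey

/-!
The torus is built up one factor at a time, starting from a single cycle `C_z` with `4 ∣ z`, and
keeping a decomposition into cycles with equally many edges of every colour, that is, of every
dimension. Suppose that `G` has such a decomposition with `R` edges of each colour in each cycle,
where `4 ∣ R`. By Hall's theorem every vertex of `G` can be assigned to a cycle through it, in such
a way that each cycle receives `R` vertices. Cut every cycle into four arcs at four of its assigned
vertices, and lift each arc to a path in `G □ C_z` that moves between two adjacent copies of the
arc: it changes the copy exactly at the assigned vertices in its interior. Over a single cycle, the
lifted arcs and the unused copies of the four cutting vertices then form a subdivision of
`C_4 □ C_z`, and a decomposition of `C_4 □ C_z` into cycles with `c` edges in each column and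
`4 * c` vertical edges turns into a balanced decomposition of `G □ C_z` with `c * R` edges of each
colour. Such decompositions of `C_4 □ C_z` exist when `c = 1`, when `2 * c = z`, and when `c` is
even and `2 * c ∣ z`.
-/

namespace LockKey

open scoped Graph

/-- A multigraph with coloured edges, each directed from `src` to `tgt`. The directions serve only
to name the two ways of traversing an edge. -/
structure ColoredGraph (V E ι : Type*) where
  src : E → V
  tgt : E → V
  color : E → ι

/-- The walk `l` traversed backwards. -/
def revWalk {E : Type*} (l : List (E × Bool)) : List (E × Bool) :=
  (l.map fun a => (a.1, !a.2)).reverse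

theorem map_fst_revWalk {E : Type*} (l : List (E × Bool)) :
    ((revWalk l).map Prod.fst).Perm (l.map Prod.fst) := by
  simp only [revWalk, List.map_reverse, List.map_map, Function.comp_def]
  exact List.reverse_perm _

theorem sum_map_comp_eq_sum_countP {α β : Type*} [Fintype β] [DecidableEq β] (g : α → β)
    (w : β → ℕ) (l : List α) :
    (l.map fun a => w (g a)).sum = ∑ b, l.countP (g · = b) * w b := by
  induction l with
  | nil => simp
  | cons a l ih => simp [ih, List.countP_cons, add_mul, Finset.sum_add_distrib, add_comm]

theorem countP_eq_ite_mem_of_nodup_map {α β : Type*} [DecidableEq β] {g : α → β} {l : List α}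
    (hl : (l.map g).Nodup) (b : β) : l.countP (g · = b) = if b ∈ l.map g then 1 else 0 := by
  have h : l.countP (g · = b) = (l.map g).count b := by
    rw [List.count, List.countP_map]
    exact List.countP_congr fun a _ => by simp
  rw [h, hl.count]

namespace ColoredGraph

variable {V E ι V' E' ι' : Type*}

/-- The vertex at which a dart starts. The dart `(e, true)` is the edge `e` traversed from `src e`
to `tgt e`, and `(e, false)` is the same edge traversed from `tgt e` to `src e`. -/
def tail (G : ColoredGraph V E ι) (a : E × Bool) : V := bif a.2 then G.src a.1 else G.tgt a.1

/-- The vertex at which a dart ends. -/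
def head (G : ColoredGraph V E ι) (a : E × Bool) : V := bif a.2 then G.tgt a.1 else G.src a.1

/-- The list `l` of darts is a walk from `u` to `w`. -/
def IsWalk (G : ColoredGraph V E ι) : V → List (E × Bool) → V → Prop
  | u, [], w => u = w
  | u, a :: l, w => G.tail a = u ∧ G.IsWalk (G.head a) l w

/-- The maps `φ` on vertices and `ψ` on darts are compatible with the two ends of a dart. -/
structure IsDartHom (G : ColoredGraph V E ι) (G' : ColoredGraph V' E' ι') (φ : V → V')
    (ψ : E × Bool → E' × Bool) : Prop where
  tail : ∀ a, G'.tail (ψ a) = φ (G.tail a)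
  head : ∀ a, G'.head (ψ a) = φ (G.head a)

@[simp] theorem tail_true (G : ColoredGraph V E ι) (e : E) : G.tail (e, true) = G.src e := rfl

@[simp] theorem tail_false (G : ColoredGraph V E ι) (e : E) : G.tail (e, false) = G.tgt e := rfl

@[simp] theorem head_true (G : ColoredGraph V E ι) (e : E) : G.head (e, true) = G.tgt e := rfl

@[simp] theorem head_false (G : ColoredGraph V E ι) (e : E) : G.head (e, false) = G.src e := rfl

variable {G : ColoredGraph V E ι} {G' : ColoredGraph V' E' ι'} {u v w : V} {l l' : List (E × Bool)}

theorem tail_not (a : E × Bool) : G.tail (a.1, !a.2) = G.head a := by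
  rcases a with ⟨e, _ | _⟩ <;> rfl

theorem head_not (a : E × Bool) : G.head (a.1, !a.2) = G.tail a := by
  rcases a with ⟨e, _ | _⟩ <;> rfl

theorem map_tail_revWalk (l : List (E × Bool)) :
    (revWalk l).map G.tail = (l.map G.head).reverse := by
  simp only [revWalk, List.map_reverse, List.map_map, Function.comp_def, tail_not]

theorem isWalk_append_iff :
    G.IsWalk u (l ++ l') w ↔ ∃ v, G.IsWalk u l v ∧ G.IsWalk v l' w := by
  induction l generalizing u with
  | nil => exact ⟨fun h => ⟨u, rfl, h⟩, by rintro ⟨v, rfl, h⟩; exact h⟩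
  | cons a l ih => simp only [List.cons_append, IsWalk, ih, and_assoc, exists_and_left]

theorem IsWalk.append (h : G.IsWalk u l v) (h' : G.IsWalk v l' w) : G.IsWalk u (l ++ l') w :=
  isWalk_append_iff.2 ⟨v, h, h'⟩

theorem IsWalk.reverse (h : G.IsWalk u l w) : G.IsWalk w (revWalk l) u := by
  induction l generalizing u with
  | nil => exact h.symm
  | cons a l ih =>
    have hcons : revWalk (a :: l) = revWalk l ++ [(a.1, !a.2)] := by
      simp only [revWalk, List.map_cons, List.reverse_cons]
    exact hcons ▸ (ih h.2).append ⟨tail_not a, (head_not a).trans h.1⟩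

theorem IsWalk.map_tail_append (h : G.IsWalk u l w) :
    l.map G.tail ++ [w] = u :: l.map G.head := by
  induction l generalizing u with
  | nil => cases h; rfl
  | cons a l ih => rw [List.map_cons, List.cons_append, ih h.2, h.1, List.map_cons]

theorem IsWalk.map {φ : V → V'} {ψ : E × Bool → E' × Bool} (h : G.IsWalk u l w)
    (hφ : IsDartHom G G' φ ψ) : G'.IsWalk (φ u) (l.map ψ) (φ w) := by
  induction l generalizing u with
  | nil => cases h; rfl
  | cons a l ih =>
    obtain ⟨rfl, h⟩ := h
    exact ⟨hφ.tail a, (hφ.head a).symm ▸ ih h⟩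

theorem IsDartHom.nodup_map_tail {φ : V → V'} {ψ : E × Bool → E' × Bool}
    (hφ : IsDartHom G G' φ ψ) (hinj : φ.Injective) (hl : (l.map G.tail).Nodup) :
    ((l.map ψ).map G'.tail).Nodup := by
  have h : (l.map ψ).map G'.tail = (l.map G.tail).map φ := by
    simp only [List.map_map, Function.comp_def, hφ.tail]
  exact h ▸ hl.map hinj

theorem isWalk_flatMap_range (v : ℕ → V) (f : ℕ → List (E × Bool)) (n : ℕ)
    (h : ∀ k < n, G.IsWalk (v k) (f k) (v (k + 1))) :
    G.IsWalk (v 0) ((List.range n).flatMap f) (v n) := by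
  induction n with
  | zero => rfl
  | succ n ih =>
    rw [List.range_succ, List.flatMap_append, List.flatMap_singleton]
    exact (ih fun k hk => h k (hk.trans n.lt_succ_self)).append (h n n.lt_succ_self)

/-- A family of closed walks without repeated vertices which together use every edge exactly
once. -/
structure IsCycleDecomp {J : Type*} [Fintype J] [DecidableEq E] (G : ColoredGraph V E ι)
    (l : J → List (E × Bool)) : Prop where
  closed : ∀ j, ∃ u, G.IsWalk u (l j) u
  nodup : ∀ j, ((l j).map G.tail).Nodup
  cover : ∀ e, ∑ j, (l j).countP (·.1 = e) = 1

/-- The graph has a decomposition into cycles with exactly `R` edges of each colour. -/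
def HasBalancedDecomp [DecidableEq E] [DecidableEq ι] (G : ColoredGraph V E ι) (R : ℕ) : Prop :=
  ∃ (J : Type) (_ : Fintype J) (l : J → List (E × Bool)), G.IsCycleDecomp l ∧
    ∀ j i, (l j).countP (G.color ·.1 = i) = R

namespace IsCycleDecomp

variable {J : Type*} [Fintype J] [DecidableEq E] {l : J → List (E × Bool)}

theorem nodup_edges (h : G.IsCycleDecomp l) (j : J) : ((l j).map Prod.fst).Nodup := by
  refine List.nodup_iff_count_le_one.2 fun e => ?_
  rw [List.count, List.countP_map, ← h.cover e]
  exact Finset.single_le_sum (f := fun j => (l j).countP (·.1 = e)) (fun _ _ => Nat.zero_le _)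
    (Finset.mem_univ j)

theorem sum_sum_map [Fintype E] (h : G.IsCycleDecomp l) (w : E → ℕ) :
    ∑ j, ((l j).map fun a => w a.1).sum = ∑ e, w e := by
  simp only [sum_map_comp_eq_sum_countP Prod.fst w]
  rw [Finset.sum_comm]
  simp only [← Finset.sum_mul, h.cover, one_mul]

end IsCycleDecomp

/-- A system of walks in `G'` along the edges of `G`: the vertices of `G` are embedded in `G'` by
`vert`, and the edge `e` becomes a path from `vert (src e)` to `vert (tgt e)` with inner vertices
`inner e`, none of them in the image of `vert`. The paths of different edges may intersect. -/
structure PathSystem (G : ColoredGraph V E ι) (G' : ColoredGraph V' E' ι') where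
  vert : V → V'
  path : E → List (E' × Bool)
  inner : E → List V'
  vert_injective : vert.Injective
  isWalk : ∀ e, G'.IsWalk (vert (G.src e)) (path e) (vert (G.tgt e))
  map_tail_path : ∀ e, (path e).map G'.tail = vert (G.src e) :: inner e
  nodup_inner : ∀ e, (inner e).Nodup
  vert_notMem_inner : ∀ e v, vert v ∉ inner e

namespace PathSystem

variable (P : PathSystem G G') {l : List (E × Bool)}

/-- The path of the edge of a dart, traversed in the direction of the dart. -/
def expand (a : E × Bool) : List (E' × Bool) := bif a.2 then P.path a.1 else revWalk (P.path a.1)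

theorem isWalk_expand (a : E × Bool) :
    G'.IsWalk (P.vert (G.tail a)) (P.expand a) (P.vert (G.head a)) := by
  rcases a with ⟨e, _ | _⟩
  · exact (P.isWalk e).reverse
  · exact P.isWalk e

theorem isWalk_flatMap_expand (h : G.IsWalk u l w) :
    G'.IsWalk (P.vert u) (l.flatMap P.expand) (P.vert w) := by
  induction l generalizing u with
  | nil => cases h; rfl
  | cons a l ih =>
    obtain ⟨rfl, h⟩ := h
    exact (P.isWalk_expand a).append (ih h)

theorem map_tail_expand_perm (a : E × Bool) :
    ((P.expand a).map G'.tail).Perm (P.vert (G.tail a) :: P.inner a.1) := by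
  rcases a with ⟨e, _ | _⟩
  · have h := (P.isWalk e).map_tail_append
    rw [P.map_tail_path, List.cons_append, List.cons.injEq] at h
    simp only [expand, cond_false, map_tail_revWalk, ← h.2, List.reverse_append]
    exact (List.reverse_perm _).cons _
  · exact .of_eq (P.map_tail_path e)

theorem countP_expand (q : E' → Bool) (a : E × Bool) :
    (P.expand a).countP (q ·.1) = (P.path a.1).countP (q ·.1) := by
  have h : ((P.expand a).map Prod.fst).Perm ((P.path a.1).map Prod.fst) := by
    rcases a with ⟨e, _ | _⟩
    · exact map_fst_revWalk _
    · exact List.Perm.refl _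
  simpa only [List.countP_map, Function.comp_def] using h.countP_eq q

theorem countP_flatMap_expand (q : E' → Bool) (l : List (E × Bool)) :
    (l.flatMap P.expand).countP (q ·.1) =
      (l.map fun a => (P.path a.1).countP (q ·.1)).sum := by
  simp only [List.countP_flatMap, Function.comp_def, P.countP_expand]

theorem nodup_map_tail_flatMap_expand (hl : (l.map G.tail).Nodup) (hl' : (l.map Prod.fst).Nodup)
    (hd : ∀ e ∈ l.map Prod.fst, ∀ e' ∈ l.map Prod.fst, e ≠ e' →
      (P.inner e).Disjoint (P.inner e')) :
    ((l.flatMap P.expand).map G'.tail).Nodup := by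
  rw [List.map_flatMap, List.nodup_flatMap]
  constructor
  · intro a _
    rw [(P.map_tail_expand_perm a).nodup_iff, List.nodup_cons]
    exact ⟨P.vert_notMem_inner _ _, P.nodup_inner _⟩
  · refine ((List.pairwise_map.1 hl).and (List.pairwise_map.1 hl')).imp_of_mem
      fun {a b} ha hb hab x hxa hxb => ?_
    have hxa := (P.map_tail_expand_perm a).subset hxa
    have hxb := (P.map_tail_expand_perm b).subset hxb
    rw [List.mem_cons] at hxa hxb
    rcases hxa with rfl | hxa <;> rcases hxb with hxb | hxb
    · exact hab.1 (P.vert_injective hxb)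
    · exact P.vert_notMem_inner _ _ hxb
    · exact P.vert_notMem_inner a.1 _ (hxb ▸ hxa)
    · exact hd _ (List.mem_map_of_mem ha) _ (List.mem_map_of_mem hb) hab.2 hxa hxb

end PathSystem

end ColoredGraph

section Assignment

/-- Hall's theorem, applied to `R` copies of every `j`. -/
theorem exists_assignment_of_card {α J : Type*} [Fintype α] [Fintype J] [DecidableEq J]
    (r : α → J → Prop) [∀ v, DecidablePred (r v)] {n R : ℕ} (hn : 0 < n)
    (hα : ∀ v, (Finset.univ.filter fun j => r v j).card = n)
    (hJ : ∀ j, (Finset.univ.filter fun v => r v j).card = n * R) :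
    ∃ f : α → J, (∀ v, r v (f v)) ∧ ∀ j, (Finset.univ.filter fun v => f v = j).card = R := by
  let nbhd : α → Finset (J × Fin R) := fun v => Finset.univ.filter (r v) ×ˢ Finset.univ
  have hall (s : Finset α) : s.card ≤ (s.biUnion nbhd).card := by
    let N := s.biUnion fun v => Finset.univ.filter (r v)
    have hN : s.biUnion nbhd = N ×ˢ Finset.univ := by
      ext p
      simp only [nbhd, N, Finset.mem_biUnion, Finset.mem_product, Finset.mem_univ, and_true]
    have hle : s.card * n ≤ N.card * (n * R) := by
      refine Finset.card_mul_le_card_mul r (fun v hv => ?_) fun j _ => ?_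
      · rw [← hα v]
        refine Finset.card_le_card fun j hj => (Finset.mem_bipartiteAbove r).2 ⟨?_, ?_⟩
        · exact Finset.mem_biUnion.2 ⟨v, hv, hj⟩
        · exact (Finset.mem_filter.1 hj).2
      · rw [← hJ j]
        exact Finset.card_le_card (Finset.filter_subset_filter _ (Finset.subset_univ s))
    rw [hN, Finset.card_product, Finset.card_univ, Fintype.card_fin]
    exact Nat.le_of_mul_le_mul_right (hle.trans_eq (by ring)) hn
  have hcard : Fintype.card α = Fintype.card (J × Fin R) := by
    have h := Finset.card_mul_eq_card_mul r (s := Finset.univ) (t := Finset.univ)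
      (fun v _ => hα v) fun j _ => hJ j
    simp only [Finset.card_univ] at h
    rw [Fintype.card_prod, Fintype.card_fin]
    exact Nat.eq_of_mul_eq_mul_right hn (h.trans (by ring))
  obtain ⟨g, hg, hgmem⟩ := (Finset.all_card_le_biUnion_card_iff_exists_injective nbhd).1 hall
  refine ⟨fun v => (g v).1, fun v => ?_, fun j => ?_⟩
  · exact (Finset.mem_filter.1 (Finset.mem_product.1 (hgmem v)).1).2
  · have hbij : g.Bijective := (Fintype.bijective_iff_injective_and_card g).2 ⟨hg, hcard⟩
    have hfibre : ∀ v, v ∈ Finset.univ.filter (fun v => (g v).1 = j) ↔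
        g v ∈ ({j} : Finset J) ×ˢ (Finset.univ : Finset (Fin R)) := fun v => by
      simp [Prod.ext_iff, eq_comm]
    rw [Finset.card_bijective g hbij hfibre]
    simp

namespace ColoredGraph

variable {V E ι : Type*} {G : ColoredGraph V E ι}

/-- Every vertex is the source of exactly `d` edges and the target of exactly `d` edges. -/
structure IsDiregular [Fintype E] [DecidableEq V] (G : ColoredGraph V E ι) (d : ℕ) : Prop where
  card_src : ∀ v, (Finset.univ.filter fun e => G.src e = v).card = d
  card_tgt : ∀ v, (Finset.univ.filter fun e => G.tgt e = v).card = d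

theorem IsWalk.countP_tail_eq_countP_head [DecidableEq V] {u : V} {p : List (E × Bool)}
    (h : G.IsWalk u p u) (v : V) : p.countP (G.tail · = v) = p.countP (G.head · = v) := by
  have h := congrArg (List.countP (· = v)) h.map_tail_append
  rw [List.countP_append, List.countP_singleton, List.countP_cons] at h
  simpa only [List.countP_map, Function.comp_def, Nat.add_right_cancel_iff] using h

theorem countP_tail_add_countP_head [DecidableEq V] (p : List (E × Bool)) (v : V) :
    p.countP (G.tail · = v) + p.countP (G.head · = v) =
      (p.map fun a =>
        (if G.src a.1 = v then 1 else 0) + (if G.tgt a.1 = v then 1 else 0)).sum := by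
  induction p with
  | nil => rfl
  | cons a p ih =>
    rcases a with ⟨e, _ | _⟩ <;> grind [tail_true, tail_false, head_true, head_false]

namespace IsCycleDecomp

variable {J : Type*} [Fintype J] [DecidableEq E] [DecidableEq V] [Fintype E]
  {l : J → List (E × Bool)} {d : ℕ}

theorem sum_countP_tail (h : G.IsCycleDecomp l) (hG : G.IsDiregular d) (v : V) :
    ∑ j, (l j).countP (G.tail · = v) = d := by
  have hsum := h.sum_sum_map fun e =>
    (if G.src e = v then 1 else 0) + (if G.tgt e = v then 1 else 0)
  have hhead (j) : (l j).countP (G.head · = v) = (l j).countP (G.tail · = v) :=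
    (h.closed j).elim fun u hu => (hu.countP_tail_eq_countP_head v).symm
  simp only [← countP_tail_add_countP_head, hhead, Finset.sum_add_distrib, Finset.sum_boole,
    hG.card_src, hG.card_tgt, Nat.cast_id] at hsum
  lia

theorem card_filter_mem_map_tail (h : G.IsCycleDecomp l) (hG : G.IsDiregular d) (v : V) :
    (Finset.univ.filter fun j => v ∈ (l j).map G.tail).card = d := by
  rw [← h.sum_countP_tail hG v]
  simp only [countP_eq_ite_mem_of_nodup_map (h.nodup _), Finset.sum_boole, Nat.cast_id]

theorem exists_assignment [Fintype V] [DecidableEq J] (h : G.IsCycleDecomp l)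
    (hG : G.IsDiregular d) (hd : 0 < d) {R : ℕ} (hlen : ∀ j, (l j).length = d * R) :
    ∃ f : V → J, (∀ v, v ∈ (l (f v)).map G.tail) ∧
      ∀ j, (Finset.univ.filter fun v => f v = j).card = R := by
  refine exists_assignment_of_card (fun v j => v ∈ (l j).map G.tail) hd
    (h.card_filter_mem_map_tail hG) fun j => ?_
  have hfilter : (Finset.univ.filter fun v => v ∈ (l j).map G.tail) =
      ((l j).map G.tail).toFinset := by
    ext v
    simp only [Finset.mem_filter, Finset.mem_univ, true_and, List.mem_toFinset]
  rw [hfilter, List.toFinset_card_of_nodup (h.nodup j), List.length_map, hlen]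

end IsCycleDecomp

theorem length_eq_card_mul [Fintype ι] [DecidableEq ι] {R : ℕ} {p : List (E × Bool)}
    (h : ∀ i, p.countP (G.color ·.1 = i) = R) : p.length = Fintype.card ι * R := by
  have hsum := sum_map_comp_eq_sum_countP (fun a : E × Bool => G.color a.1) (fun _ => 1) p
  simpa [h] using hsum

end ColoredGraph

end Assignment

namespace ColoredGraph

section Cylinder

variable {V E ι : Type*}

/-- The product of a graph with the cycle `C_z`. The edges of `C_z` get the new colour `none`. -/
def cylinder (G : ColoredGraph V E ι) (z : ℕ) :
    ColoredGraph (V × ZMod z) ((E × ZMod z) ⊕ (V × ZMod z)) (Option ι) where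
  src := Sum.elim (fun p => (G.src p.1, p.2)) id
  tgt := Sum.elim (fun p => (G.tgt p.1, p.2)) fun p => (p.1, p.2 + 1)
  color := Sum.elim (fun p => some (G.color p.1)) fun _ => none

/-- The copy of a dart at height `h` of the cylinder. -/
def liftDart {V : Type*} {z : ℕ} (h : ZMod z) (a : E × Bool) :
    ((E × ZMod z) ⊕ (V × ZMod z)) × Bool :=
  (.inl (a.1, h), a.2)

/-- The height `h + 1` if `b` holds, and `h` otherwise. -/
def level {z : ℕ} (h : ZMod z) (b : Bool) : ZMod z := bif b then h + 1 else h

variable {G : ColoredGraph V E ι} {z : ℕ}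

@[simp] theorem color_cylinder_inl (e : E) (h : ZMod z) :
    (G.cylinder z).color (.inl (e, h)) = some (G.color e) := rfl

@[simp] theorem color_cylinder_inr (v : V) (h : ZMod z) :
    (G.cylinder z).color (.inr (v, h)) = none := rfl

theorem isDartHom_liftDart (G : ColoredGraph V E ι) (h : ZMod z) :
    IsDartHom G (G.cylinder z) (·, h) (liftDart h) where
  tail := by rintro ⟨e, _ | _⟩ <;> rfl
  head := by rintro ⟨e, _ | _⟩ <;> rfl

theorem tail_rung (v : V) (h : ZMod z) (b : Bool) :
    (G.cylinder z).tail (.inr (v, h), !b) = (v, level h b) := by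
  cases b <;> rfl

theorem head_rung (v : V) (h : ZMod z) (b : Bool) :
    (G.cylinder z).head (.inr (v, h), !b) = (v, level h !b) := by
  cases b <;> rfl

theorem level_eq_or_eq (h : ZMod z) (b : Bool) : level h b = h ∨ level h b = h + 1 := by
  cases b
  exacts [.inl rfl, .inr rfl]

theorem sum_ite_level_eq [NeZero z] (b : Bool) (y : ZMod z) :
    ∑ h : ZMod z, (if level h b = y then 1 else 0) = 1 := by
  have hlevel (h : ZMod z) : level h b = y ↔ h = bif b then y - 1 else y := by
    cases b
    exacts [Iff.rfl, eq_sub_iff_add_eq.symm]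
  simp only [hlevel, Finset.sum_ite_eq', Finset.mem_univ, if_true]

variable (G) (S : V → Prop) [DecidablePred S]

/-- Lift a walk to the cylinder, switching between the heights `h` and `h + 1` at each vertex
in `S`; the flag tells whether the lift is at height `h + 1`. -/
def zigzag (h : ZMod z) : Bool → List (E × Bool) → List (((E × ZMod z) ⊕ (V × ZMod z)) × Bool)
  | _, [] => []
  | b, a :: l =>
    if S (G.tail a) then
      (.inr (G.tail a, h), !b) :: liftDart (level h !b) a :: zigzag h (!b) l
    else liftDart (level h b) a :: zigzag h b l

variable {G S}

theorem IsWalk.zigzag {u w : V} {l : List (E × Bool)} (hl : G.IsWalk u l w) (h : ZMod z)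
    (b : Bool) :
    (G.cylinder z).IsWalk (u, level h b) (G.zigzag S h b l)
      (w, level h (b ^^ (l.countP (S <| G.tail ·)).bodd)) := by
  induction l generalizing u b with
  | nil =>
    cases hl
    simp [ColoredGraph.zigzag, IsWalk]
  | cons a l ih =>
    obtain ⟨rfl, hl⟩ := hl
    by_cases ha : S (G.tail a)
    · rw [ColoredGraph.zigzag, if_pos ha, List.countP_cons_of_pos (by simpa using ha)]
      refine ⟨tail_rung _ h b, ?_, ?_⟩
      · rw [head_rung, (isDartHom_liftDart G _).tail]
      · rw [(isDartHom_liftDart G _).head]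
        simpa using ih hl (!b)
    · rw [ColoredGraph.zigzag, if_neg ha, List.countP_cons_of_neg (by simpa using ha)]
      refine ⟨(isDartHom_liftDart G _).tail a, ?_⟩
      rw [(isDartHom_liftDart G _).head]
      exact ih hl b

theorem IsWalk.zigzag_of_even {u w : V} {l : List (E × Bool)} (hl : G.IsWalk u l w) (h : ZMod z)
    (b : Bool) (heven : Even (l.countP (S <| G.tail ·))) :
    (G.cylinder z).IsWalk (u, level h b) (G.zigzag S h b l) (w, level h b) := by
  obtain ⟨k, hk⟩ := heven
  simpa [hk] using hl.zigzag (S := S) h b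

theorem mem_map_tail_zigzag {h : ZMod z} {b : Bool} {l : List (E × Bool)} {x : V × ZMod z}
    (hx : x ∈ (G.zigzag S h b l).map (G.cylinder z).tail) :
    x.1 ∈ l.map G.tail ∧ (x.2 = h ∨ x.2 = h + 1) := by
  induction l generalizing b with
  | nil => simp [zigzag] at hx
  | cons a l ih =>
    by_cases ha : S (G.tail a)
    · rw [zigzag, if_pos ha] at hx
      simp only [List.map_cons, List.mem_cons, tail_rung, (isDartHom_liftDart G _).tail] at hx ⊢
      rcases hx with rfl | rfl | hx
      · exact ⟨.inl rfl, level_eq_or_eq h b⟩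
      · exact ⟨.inl rfl, level_eq_or_eq h !b⟩
      · exact ⟨.inr (ih hx).1, (ih hx).2⟩
    · rw [zigzag, if_neg ha] at hx
      simp only [List.map_cons, List.mem_cons, (isDartHom_liftDart G _).tail] at hx ⊢
      rcases hx with rfl | hx
      · exact ⟨.inl rfl, level_eq_or_eq h b⟩
      · exact ⟨.inr (ih hx).1, (ih hx).2⟩

theorem zigzag_eq_map_liftDart {h : ZMod z} {b : Bool} {l : List (E × Bool)}
    (hl : ∀ a ∈ l, ¬ S (G.tail a)) : G.zigzag S h b l = l.map (liftDart (level h b)) := by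
  induction l with
  | nil => rfl
  | cons a l ih =>
    rw [zigzag, if_neg (hl a List.mem_cons_self), List.map_cons,
      ih fun a ha => hl a (List.mem_cons_of_mem _ ha)]

theorem nodup_map_tail_zigzag (hz : 1 < z) (h : ZMod z) (b : Bool) {l : List (E × Bool)}
    (hl : (l.map G.tail).Nodup) : ((G.zigzag S h b l).map (G.cylinder z).tail).Nodup := by
  have : Fact (1 < z) := ⟨hz⟩
  induction l generalizing b with
  | nil => exact List.nodup_nil
  | cons a l ih =>
    rw [List.map_cons, List.nodup_cons] at hl
    have hnotMem (y b) : (G.tail a, y) ∉ (G.zigzag S h b l).map (G.cylinder z).tail :=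
      fun hy => hl.1 (mem_map_tail_zigzag hy).1
    by_cases ha : S (G.tail a)
    · rw [zigzag, if_pos ha]
      simp only [List.map_cons, List.nodup_cons, tail_rung, (isDartHom_liftDart G _).tail,
        List.mem_cons, not_or]
      refine ⟨⟨?_, hnotMem _ _⟩, hnotMem _ _, ih _ hl.2⟩
      cases b <;> simp [level]
    · rw [zigzag, if_neg ha]
      simp only [List.map_cons, List.nodup_cons, (isDartHom_liftDart G _).tail]
      exact ⟨hnotMem _ _, ih _ hl.2⟩

theorem sum_ite_liftDart_eq_inl [DecidableEq E] [DecidableEq V] [NeZero z] (b : Bool)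
    (a : E × Bool) (e : E) (y : ZMod z) :
    ∑ h : ZMod z, (if (liftDart (V := V) (level h b) a).1 = .inl (e, y) then 1 else 0) =
      if a.1 = e then 1 else 0 := by
  by_cases he : a.1 = e
  · simpa [liftDart, he] using sum_ite_level_eq b y
  · simp [liftDart, he]

theorem sum_countP_inl_zigzag [DecidableEq E] [DecidableEq V] [NeZero z] (b : Bool)
    (l : List (E × Bool)) (e : E) (y : ZMod z) :
    ∑ h : ZMod z, (G.zigzag S h b l).countP (·.1 = .inl (e, y)) = l.countP (·.1 = e) := by
  induction l generalizing b with
  | nil => simp [zigzag]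
  | cons a l ih =>
    by_cases ha : S (G.tail a) <;>
      simp [zigzag, ha, List.countP_cons, Finset.sum_add_distrib, ih,
        sum_ite_liftDart_eq_inl, -Finset.sum_boole]

theorem sum_countP_inr_zigzag [DecidableEq E] [DecidableEq V] [NeZero z] (b : Bool)
    (l : List (E × Bool)) (v : V) (y : ZMod z) :
    ∑ h : ZMod z, (G.zigzag S h b l).countP (·.1 = .inr (v, y)) =
      if S v then l.countP (G.tail · = v) else 0 := by
  induction l generalizing b with
  | nil => simp [zigzag]
  | cons a l ih =>
    by_cases hv : G.tail a = v
    · subst hv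
      by_cases ha : S (G.tail a) <;>
        simp [zigzag, ha, liftDart, List.countP_cons, Finset.sum_add_distrib, ih]
    · by_cases ha : S (G.tail a) <;>
        simp [zigzag, ha, hv, liftDart, ih]

theorem countP_color_zigzag [DecidableEq ι] (h : ZMod z) (b : Bool) (l : List (E × Bool))
    (k : Option ι) : (G.zigzag S h b l).countP ((G.cylinder z).color ·.1 = k) =
      k.elim (l.countP (S <| G.tail ·)) fun i => l.countP (G.color ·.1 = i) := by
  induction l generalizing b with
  | nil => cases k <;> rfl
  | cons a l ih =>
    cases k <;> by_cases ha : S (G.tail a) <;> simp [zigzag, ha, liftDart, List.countP_cons, ih]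

end Cylinder

section ArcCut

variable {V E ι : Type*} {G : ColoredGraph V E ι} {S : V → Prop} {p : List (E × Bool)} {u w : V}

/-- A way of cutting the closed walk `p`, up to rotation, into four arcs starting in `S` of which
only the first may meet `S` again. The `i`-th arc is `first i :: rest i`. -/
structure ArcCut (G : ColoredGraph V E ι) (S : V → Prop) (p : List (E × Bool)) where
  first : Fin 4 → E × Bool
  rest : Fin 4 → List (E × Bool)
  perm : ((List.finRange 4).flatMap fun i => first i :: rest i).Perm p
  isWalk : ∀ i, G.IsWalk (G.tail (first i)) (first i :: rest i) (G.tail (first (i + 1)))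
  tail_first_mem : ∀ i, S (G.tail (first i))
  tail_rest_notMem : ∀ i, i ≠ 0 → ∀ a ∈ rest i, ¬ S (G.tail a)

theorem IsWalk.exists_split_first [DecidablePred S] (hp : G.IsWalk u p w)
    (h : 0 < p.countP (S <| G.tail ·)) :
    ∃ q a r, p = q ++ a :: r ∧ S (G.tail a) ∧ (∀ x ∈ q, ¬ S (G.tail x)) ∧
      G.IsWalk u q (G.tail a) ∧ G.IsWalk (G.tail a) (a :: r) w := by
  obtain ⟨x, hx⟩ := Option.isSome_iff_exists.1 (List.find?_isSome.2
    ((List.countP_pos_iff (p := (S <| G.tail ·))).1 h))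
  obtain ⟨hS, q, r, rfl, hq⟩ := List.find?_eq_some_iff_append.1 hx
  obtain ⟨v, hv, hr⟩ := isWalk_append_iff.1 hp
  obtain rfl := hr.1
  exact ⟨q, x, r, rfl, by simpa using hS, by simpa using hq, hv, hr⟩

theorem IsWalk.exists_split_last [DecidablePred S] (hp : G.IsWalk u p w)
    (h : 0 < p.countP (S <| G.tail ·)) :
    ∃ q a r, p = q ++ a :: r ∧ S (G.tail a) ∧ (∀ x ∈ r, ¬ S (G.tail x)) ∧
      p.countP (S <| G.tail ·) = q.countP (S <| G.tail ·) + 1 ∧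
      G.IsWalk u q (G.tail a) ∧ G.IsWalk (G.tail a) (a :: r) w := by
  rw [← List.countP_reverse] at h
  obtain ⟨x, hx⟩ := Option.isSome_iff_exists.1 (List.find?_isSome.2
    ((List.countP_pos_iff (p := (S <| G.tail ·))).1 h))
  obtain ⟨hS, r, q, hrev, hr⟩ := List.find?_eq_some_iff_append.1 hx
  obtain rfl : p = q.reverse ++ x :: r.reverse := by
    rw [← List.reverse_reverse p, hrev, List.reverse_append, List.reverse_cons, List.append_assoc,
      List.singleton_append]
  obtain ⟨v, hv, hx⟩ := isWalk_append_iff.1 hp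
  obtain rfl := hx.1
  replace hr : ∀ a ∈ r.reverse, ¬ S (G.tail a) := fun a ha => by
    simpa only [Bool.not_eq_true', decide_eq_false_iff_not] using hr a (List.mem_reverse.1 ha)
  have hzero : r.reverse.countP (S <| G.tail ·) = 0 :=
    List.countP_eq_zero.2 fun a ha => by simpa only [decide_eq_true_eq] using hr a ha
  refine ⟨q.reverse, x, r.reverse, rfl, of_decide_eq_true hS, hr, ?_, hv, hx⟩
  rw [List.countP_append, List.countP_cons_of_pos (p := (S <| G.tail ·)) hS, hzero]

theorem IsWalk.nonempty_arcCut [DecidablePred S] (hp : G.IsWalk u p u)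
    (h4 : 4 ≤ p.countP (S <| G.tail ·)) :
    Nonempty (ArcCut G S p) := by
  obtain ⟨p₃, a₃, r₃, rfl, ha₃, hr₃, hc₃, hp, hw₃⟩ := hp.exists_split_last (S := S) (by lia)
  obtain ⟨p₂, a₂, r₂, rfl, ha₂, hr₂, hc₂, hp, hw₂⟩ := hp.exists_split_last (S := S) (by lia)
  obtain ⟨p₁, a₁, r₁, rfl, ha₁, hr₁, hc₁, hp, hw₁⟩ := hp.exists_split_last (S := S) (by lia)
  obtain ⟨q, a₀, r₀, rfl, ha₀, hq, hp, hw₀⟩ := hp.exists_split_first (S := S) (by lia)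
  refine ⟨![a₀, a₁, a₂, a₃], ![r₀, r₁, r₂, r₃ ++ q], ?_, ?_, ?_, ?_⟩
  · have hrotate : ((List.finRange 4).flatMap fun i =>
        (![a₀, a₁, a₂, a₃] : Fin 4 → _) i :: (![r₀, r₁, r₂, r₃ ++ q] : Fin 4 → _) i) =
        (a₀ :: r₀ ++ a₁ :: r₁ ++ a₂ :: r₂ ++ a₃ :: r₃) ++ q := by
      simp [List.finRange_succ]
    rw [hrotate]
    refine List.perm_append_comm.trans (.of_eq ?_)
    simp only [List.append_assoc]
  · intro i
    fin_cases i
    exacts [hw₀, hw₁, hw₂, hw₃.append hp]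
  · intro i
    fin_cases i
    exacts [ha₀, ha₁, ha₂, ha₃]
  · intro i hi
    fin_cases i
    · exact absurd rfl hi
    · exact hr₁
    · exact hr₂
    · exact fun x hx => (List.mem_append.1 hx).elim (hr₃ x) (hq x)

namespace ArcCut

theorem sum_countP (C : ArcCut G S p) (q : E × Bool → Bool) :
    ∑ i, (C.first i :: C.rest i).countP q = p.countP q := by
  rw [← C.perm.countP_eq, List.countP_flatMap, ← List.ofFn_eq_map, List.sum_ofFn]
  rfl

theorem sum_countP_rest_add_four [DecidablePred S] (C : ArcCut G S p) :
    ∑ i, (C.rest i).countP (S <| G.tail ·) + 4 = p.countP (S <| G.tail ·) := by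
  rw [← C.sum_countP]
  simp [C.tail_first_mem, Finset.sum_add_distrib]

theorem even_countP_rest [DecidablePred S] (C : ArcCut G S p)
    (h : Even (p.countP (S <| G.tail ·))) (i : Fin 4) :
    Even ((C.rest i).countP (S <| G.tail ·)) := by
  have hzero (i) (hi : i ≠ 0) : (C.rest i).countP (S <| G.tail ·) = 0 :=
    List.countP_eq_zero.2 (by simpa using C.tail_rest_notMem i hi)
  by_cases hi : i = 0
  · rw [← C.sum_countP_rest_add_four, Finset.sum_eq_single i (fun k _ hk => hzero k (hi ▸ hk))
      (by simp), Nat.even_add] at h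
    exact h.2 (by decide)
  · rw [hzero i hi]
    exact Even.zero

theorem nodup_map_tail_arc (C : ArcCut G S p) (hp : (p.map G.tail).Nodup) (i : Fin 4) :
    ((C.first i :: C.rest i).map G.tail).Nodup := by
  have h := ((C.perm.map _).nodup_iff).2 hp
  rw [List.map_flatMap, List.nodup_flatMap] at h
  exact h.1 i (List.mem_finRange i)

theorem eq_of_mem_map_tail_arc (C : ArcCut G S p) (hp : (p.map G.tail).Nodup) {i k : Fin 4} {v : V}
    (hi : v ∈ (C.first i :: C.rest i).map G.tail) (hk : v ∈ (C.first k :: C.rest k).map G.tail) :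
    i = k := by
  have h := ((C.perm.map _).nodup_iff).2 hp
  rw [List.map_flatMap, List.nodup_flatMap] at h
  by_contra hik
  have : Std.Symm (Function.onFun List.Disjoint
      fun i => (C.first i :: C.rest i).map G.tail) := ⟨fun _ _ h => h.symm⟩
  exact h.2.forall (List.mem_finRange i) (List.mem_finRange k) hik hi hk

theorem tail_first_notMem_rest (C : ArcCut G S p) (hp : (p.map G.tail).Nodup) (i k : Fin 4) :
    G.tail (C.first i) ∉ (C.rest k).map G.tail := by
  intro h
  obtain rfl := C.eq_of_mem_map_tail_arc hp (i := i) List.mem_cons_self (List.mem_cons_of_mem _ h)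
  exact (List.nodup_cons.1 (C.nodup_map_tail_arc hp i)).1 h

end ArcCut

end ArcCut

end ColoredGraph

namespace ColoredGraph

section Substitution

variable {V E ι : Type*} {G : ColoredGraph V E ι} {S : V → Prop} {p : List (E × Bool)} {z : ℕ}

/-- The cycle `C_4`, every edge with its own colour. Its vertices and edges label the four arcs of
an `ArcCut`. -/
def cycleFour : ColoredGraph (Fin 4) (Fin 4) (Fin 4) where
  src := id
  tgt := (· + 1)
  color := id

/-- The darts of `C_4 □ C_z`. -/
abbrev ColumnDart (z : ℕ) : Type := ((Fin 4 × ZMod z) ⊕ (Fin 4 × ZMod z)) × Bool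

/-- A decomposition of `C_4 □ C_z` into cycles each of which uses each of the four columns of edges
coming from `C_4` exactly `c` times, and in the first of these columns no two consecutive edges. -/
structure IsColumnDecomp (z c : ℕ) {J : Type*} [Fintype J] (l : J → List (ColumnDart z)) : Prop
    extends (cycleFour.cylinder z).IsCycleDecomp l where
  countP_arc : ∀ j i, (l j).countP ((cycleFour.cylinder z).color ·.1 = some i) = c
  countP_rung : ∀ j, (l j).countP ((cycleFour.cylinder z).color ·.1 = none) = 4 * c
  not_adj : ∀ j h, .inl (0, h) ∈ (l j).map Prod.fst → .inl (0, h + 1) ∉ (l j).map Prod.fst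

/-- The product `C_4 □ C_z` has a decomposition as in `IsColumnDecomp`. -/
def HasColumnDecomp (z c : ℕ) : Prop :=
  ∃ (J : Type) (_ : Fintype J) (l : J → List (ColumnDart z)), IsColumnDecomp z c l

namespace ArcCut

variable [DecidablePred S] (C : ArcCut G S p)

/-- The walk in the cylinder over `G` that replaces an edge of `C_4 □ C_z`. -/
def lift : (Fin 4 × ZMod z) ⊕ (Fin 4 × ZMod z) → List (((E × ZMod z) ⊕ (V × ZMod z)) × Bool)
  | .inl (i, h) => liftDart h (C.first i) :: G.zigzag S h false (C.rest i)
  | .inr (i, h) => [(.inr (G.tail (C.first i), h), true)]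

/-- The paths replacing the edges of `C_4 □ C_z`: the edge in column `i` at height `h` becomes the
`i`-th arc, zigzagging between the heights `h` and `h + 1`. -/
def pathSystem (hz : 1 < z) (hp : (p.map G.tail).Nodup) (heven : Even (p.countP (S <| G.tail ·))) :
    PathSystem (cycleFour.cylinder z) (G.cylinder z) where
  vert x := (G.tail (C.first x.1), x.2)
  path := C.lift
  inner e := (C.lift e).tail.map (G.cylinder z).tail
  vert_injective := by
    intro x y hxy
    obtain ⟨hfirst, hheight⟩ := Prod.mk.inj hxy
    exact Prod.ext (C.eq_of_mem_map_tail_arc hp List.mem_cons_self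
      (hfirst ▸ List.mem_cons_self)) hheight
  isWalk := by
    rintro (⟨i, h⟩ | ⟨i, h⟩)
    · refine ⟨(isDartHom_liftDart G h).tail _, ?_⟩
      rw [(isDartHom_liftDart G h).head]
      exact (C.isWalk i).2.zigzag_of_even h false (C.even_countP_rest heven i)
    · exact ⟨rfl, rfl⟩
  map_tail_path
    | .inl x => congrArg (· :: _) ((isDartHom_liftDart G x.2).tail _)
    | .inr _ => rfl
  nodup_inner
    | .inl x => nodup_map_tail_zigzag hz x.2 false
        (List.nodup_cons.1 (C.nodup_map_tail_arc hp x.1)).2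
    | .inr _ => List.nodup_nil
  vert_notMem_inner
    | .inl _, _ => fun h => C.tail_first_notMem_rest hp _ _ (mem_map_tail_zigzag h).1
    | .inr _, _ => List.not_mem_nil

theorem disjoint_tail_lift (hp : (p.map G.tail).Nodup)
    {e e' : (Fin 4 × ZMod z) ⊕ (Fin 4 × ZMod z)} (hne : e ≠ e')
    (h : ∀ h, e = .inl (0, h) → e' ≠ .inl (0, h + 1))
    (h' : ∀ h, e' = .inl (0, h) → e ≠ .inl (0, h + 1)) :
    ((C.lift e).tail.map (G.cylinder z).tail).Disjoint
      ((C.lift e').tail.map (G.cylinder z).tail) := by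
  intro x hx hx'
  rcases e with ⟨i, y⟩ | ⟨i, y⟩ <;> rcases e' with ⟨k, y'⟩ | ⟨k, y'⟩
  · simp only [lift, List.tail_cons] at hx hx'
    obtain rfl := C.eq_of_mem_map_tail_arc hp (List.mem_cons_of_mem _ (mem_map_tail_zigzag hx).1)
      (List.mem_cons_of_mem _ (mem_map_tail_zigzag hx').1)
    by_cases hi : i = 0
    · subst hi
      have hy := (mem_map_tail_zigzag hx).2
      have hy' := (mem_map_tail_zigzag hx').2
      grind
    · rw [zigzag_eq_map_liftDart (C.tail_rest_notMem i hi)] at hx hx'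
      simp only [List.mem_map, exists_exists_and_eq_and, (isDartHom_liftDart G _).tail,
        level, cond_false] at hx hx'
      obtain ⟨a, -, rfl⟩ := hx
      obtain ⟨b, -, hb⟩ := hx'
      exact hne (by rw [(Prod.mk.inj hb).2])
  · exact List.not_mem_nil hx'
  · exact List.not_mem_nil hx
  · exact List.not_mem_nil hx

theorem sum_countP_inl_lift [DecidableEq E] [DecidableEq V] [NeZero z] (e : E) (y : ZMod z) :
    ∑ x, (C.lift (z := z) x).countP (·.1 = .inl (e, y)) = p.countP (·.1 = e) := by
  have hrung (x : Fin 4 × ZMod z) : (C.lift (.inr x)).countP (·.1 = .inl (e, y)) = 0 := by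
    simp [lift]
  have harc (i : Fin 4) : ∑ h, (C.lift (.inl (i, h))).countP (·.1 = .inl (e, y)) =
      (C.first i :: C.rest i).countP (·.1 = e) := by
    have hfirst := sum_ite_liftDart_eq_inl (V := V) false (C.first i) e y
    simp only [level, cond_false] at hfirst
    simp only [lift, List.countP_cons, Finset.sum_add_distrib, sum_countP_inl_zigzag,
      decide_eq_true_eq]
    exact congrArg (_ + ·) (by convert hfirst)
  rw [Fintype.sum_sum_type, Fintype.sum_prod_type]
  simp only [hrung, harc, Finset.sum_const_zero, add_zero, C.sum_countP]

theorem sum_countP_inr_lift [DecidableEq E] [DecidableEq V] [NeZero z] (v : V) (y : ZMod z) :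
    ∑ x, (C.lift (z := z) x).countP (·.1 = .inr (v, y)) =
      if S v then p.countP (G.tail · = v) else 0 := by
  have hrung (i : Fin 4) : ∑ h : ZMod z, (C.lift (.inr (i, h))).countP (·.1 = .inr (v, y)) =
      if G.tail (C.first i) = v then 1 else 0 := by
    by_cases hi : G.tail (C.first i) = v <;> simp [lift, hi]
  have harc (i : Fin 4) : ∑ h : ZMod z, (C.lift (.inl (i, h))).countP (·.1 = .inr (v, y)) =
      if S v then (C.rest i).countP (G.tail · = v) else 0 := by
    simp [lift, liftDart, sum_countP_inr_zigzag]
  rw [Fintype.sum_sum_type, Fintype.sum_prod_type, Fintype.sum_prod_type, ← C.sum_countP]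
  simp only [hrung, harc, ← Finset.sum_add_distrib]
  by_cases hv : S v
  · simp [hv, List.countP_cons]
  · have hfirst (i) : G.tail (C.first i) ≠ v := fun hi => hv (hi ▸ C.tail_first_mem i)
    simp [hv, hfirst]

/-- The number of edges of colour `k` in the lift of an edge of colour `o` of `C_4 □ C_z`. -/
def liftCount [DecidableEq ι] (k : Option ι) (o : Option (Fin 4)) : ℕ :=
  o.elim (if k = none then 1 else 0) fun i =>
    k.elim ((C.rest i).countP (S <| G.tail ·)) fun c =>
      (C.first i :: C.rest i).countP (G.color ·.1 = c)

theorem countP_color_lift [DecidableEq ι] (e : (Fin 4 × ZMod z) ⊕ (Fin 4 × ZMod z))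
    (k : Option ι) : (C.lift e).countP ((G.cylinder z).color ·.1 = k) =
      C.liftCount k ((cycleFour.cylinder z).color e) := by
  rcases e with ⟨i, h⟩ | ⟨i, h⟩
  · rw [lift, List.countP_cons, countP_color_zigzag]
    cases k <;> simp [liftCount, liftDart, cycleFour, List.countP_cons]
  · cases k <;> simp [lift, liftCount]

theorem sum_liftCount [DecidableEq ι] (k : Option ι) :
    4 * C.liftCount k none + ∑ i, C.liftCount k (some i) =
      k.elim (p.countP (S <| G.tail ·)) fun c => p.countP (G.color ·.1 = c) := by
  rcases k with _ | c
  · simp [liftCount, ← C.sum_countP_rest_add_four, add_comm]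
  · simp [liftCount, ← C.sum_countP]

end ArcCut

variable {J : Type*} [Fintype J] {c : ℕ} {q : J → List (ColumnDart z)}

theorem IsColumnDecomp.nodup_flatMap_expand [DecidablePred S] (hq : IsColumnDecomp z c q)
    (C : ArcCut G S p) (hz : 1 < z) (hp : (p.map G.tail).Nodup)
    (heven : Even (p.countP (S <| G.tail ·))) (g : J) :
    (((q g).flatMap (C.pathSystem hz hp heven).expand).map (G.cylinder z).tail).Nodup := by
  refine (C.pathSystem hz hp heven).nodup_map_tail_flatMap_expand (hq.nodup g) (hq.nodup_edges g)
    fun e he e' he' hne => C.disjoint_tail_lift hp hne ?_ ?_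
  · rintro h rfl rfl
    exact hq.not_adj g h he he'
  · rintro h rfl rfl
    exact hq.not_adj g h he' he

theorem IsColumnDecomp.countP_color_flatMap_expand [DecidablePred S] [DecidableEq ι]
    (hq : IsColumnDecomp z c q) (C : ArcCut G S p) (hz : 1 < z) (hp : (p.map G.tail).Nodup)
    (heven : Even (p.countP (S <| G.tail ·))) (g : J) (k : Option ι) :
    ((q g).flatMap (C.pathSystem hz hp heven).expand).countP ((G.cylinder z).color ·.1 = k) =
      c * k.elim (p.countP (S <| G.tail ·)) fun c => p.countP (G.color ·.1 = c) := by
  have hlift (e) : ((C.pathSystem hz hp heven).path e).countP ((G.cylinder z).color ·.1 = k) =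
      C.liftCount k ((cycleFour.cylinder z).color e) := C.countP_color_lift e k
  rw [(C.pathSystem hz hp heven).countP_flatMap_expand ((G.cylinder z).color · = k)]
  simp only [hlift]
  rw [sum_map_comp_eq_sum_countP (fun a : ColumnDart z => (cycleFour.cylinder z).color a.1)
    (C.liftCount k), Fintype.sum_option, ← C.sum_liftCount]
  simp only [hq.countP_arc, hq.countP_rung, ← Finset.mul_sum]
  ring

theorem IsColumnDecomp.sum_countP_flatMap_expand [DecidablePred S] [DecidableEq V] [DecidableEq E]
    [NeZero z] (hq : IsColumnDecomp z c q) (C : ArcCut G S p) (hz : 1 < z)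
    (hp : (p.map G.tail).Nodup) (heven : Even (p.countP (S <| G.tail ·)))
    (x : (E × ZMod z) ⊕ (V × ZMod z)) :
    ∑ g, ((q g).flatMap (C.pathSystem hz hp heven).expand).countP (·.1 = x) =
      ∑ e, (C.lift e).countP (·.1 = x) := by
  rw [← hq.sum_sum_map]
  exact Finset.sum_congr rfl fun g _ =>
    (C.pathSystem hz hp heven).countP_flatMap_expand (· = x) (q g)

theorem countP_tail_eq_card_filter [Fintype V] [DecidablePred S] (hp : (p.map G.tail).Nodup)
    (hS : ∀ v, S v → v ∈ p.map G.tail) :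
    p.countP (S <| G.tail ·) = (Finset.univ.filter S).card := by
  classical
  have hmap : p.countP (S <| G.tail ·) = ((p.map G.tail).filter (S ·)).length := by
    rw [← List.countP_eq_length_filter, List.countP_map]
    rfl
  rw [hmap, ← List.toFinset_card_of_nodup (hp.filter _)]
  congr 1
  ext v
  simpa using hS v

theorem HasBalancedDecomp.cylinder [Finite V] [DecidableEq V] [Fintype E] [DecidableEq E]
    [Fintype ι] [DecidableEq ι] [Nonempty ι] {R : ℕ} (hG : G.IsDiregular (Fintype.card ι))
    (h : G.HasBalancedDecomp R) (hz : 1 < z) (h4 : 4 ∣ R) (hR : 0 < R)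
    (hc : HasColumnDecomp z c) :
    (G.cylinder z).HasBalancedDecomp (c * R) := by
  classical
  have : NeZero z := ⟨by lia⟩
  have : Fintype V := Fintype.ofFinite V
  obtain ⟨J, _, q, hq⟩ := hc
  obtain ⟨K, _, l, hl, hcolor⟩ := h
  obtain ⟨f, hf, hfR⟩ := hl.exists_assignment hG Fintype.card_pos fun j =>
    length_eq_card_mul (hcolor j)
  choose u hu using hl.closed
  have hS (j) : ((l j).countP fun a => f (G.tail a) = j) = R := by
    rw [← hfR j]
    exact countP_tail_eq_card_filter (S := (f · = j)) (hl.nodup j) fun v hv => hv ▸ hf v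
  have hcut (j) : Nonempty (ArcCut G (f · = j) (l j)) :=
    (hu j).nonempty_arcCut ((Nat.le_of_dvd hR h4).trans_eq (hS j).symm)
  let C (j) : ArcCut G (f · = j) (l j) := (hcut j).some
  have heven (j) : Even ((l j).countP fun a => f (G.tail a) = j) := by
    rw [hS]
    exact even_iff_two_dvd.2 (dvd_trans (by decide) h4)
  refine ⟨K × J, inferInstance, fun x =>
    (q x.2).flatMap ((C x.1).pathSystem hz (hl.nodup x.1) (heven x.1)).expand, ⟨?_, ?_, ?_⟩, ?_⟩
  · rintro ⟨j, g⟩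
    obtain ⟨v, hv⟩ := hq.closed g
    exact ⟨_, PathSystem.isWalk_flatMap_expand _ hv⟩
  · exact fun x => hq.nodup_flatMap_expand (C x.1) hz (hl.nodup x.1) (heven x.1) x.2
  · intro x
    rw [Fintype.sum_prod_type, Finset.sum_congr rfl fun j _ =>
      hq.sum_countP_flatMap_expand (C j) hz (hl.nodup j) (heven j) x]
    rcases x with ⟨e, y⟩ | ⟨v, y⟩
    · simp only [ArcCut.sum_countP_inl_lift, hl.cover]
    · simp only [ArcCut.sum_countP_inr_lift, Finset.sum_ite_eq, Finset.mem_univ, if_true]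
      rw [countP_eq_ite_mem_of_nodup_map (hl.nodup _), if_pos (hf v)]
  · rintro ⟨j, g⟩ k
    rw [hq.countP_color_flatMap_expand (C j) hz (hl.nodup j) (heven j) g k]
    cases k <;> simp [hS, hcolor]

end Substitution

end ColoredGraph

namespace ColoredGraph

section Columns

variable {z c : ℕ}

theorem IsColumnDecomp.of_surjective {J : Type*} [Fintype J] [NeZero z]
    {l : J → List (ColumnDart z)} (hJ : Fintype.card J * c = z)
    (closed : ∀ j, ∃ u, (cycleFour.cylinder z).IsWalk u (l j) u)
    (nodup : ∀ j, ((l j).map (cycleFour.cylinder z).tail).Nodup)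
    (countP_arc : ∀ j i, (l j).countP ((cycleFour.cylinder z).color ·.1 = some i) = c)
    (countP_rung : ∀ j, (l j).countP ((cycleFour.cylinder z).color ·.1 = none) = 4 * c)
    (not_adj : ∀ j h, .inl (0, h) ∈ (l j).map Prod.fst → .inl (0, h + 1) ∉ (l j).map Prod.fst)
    (mem : ∀ e, ∃ j, e ∈ (l j).map Prod.fst) : IsColumnDecomp z c l := by
  refine ⟨⟨closed, nodup, ?_⟩, countP_arc, countP_rung, not_adj⟩
  have hlen (j) : (l j).length = 8 * c := by
    have h := sum_map_comp_eq_sum_countP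
      (fun a : ColumnDart z => (cycleFour.cylinder z).color a.1) (fun _ => 1) (l j)
    simp only [Fintype.sum_option, countP_arc, countP_rung, List.map_const', List.sum_replicate,
      smul_eq_mul, mul_one, Finset.sum_const, Finset.card_univ, Fintype.card_fin] at h
    lia
  have hsum : ∑ e, ∑ j, (l j).countP (·.1 = e) =
      ∑ _e : (Fin 4 × ZMod z) ⊕ (Fin 4 × ZMod z), 1 := by
    have h (j) := sum_map_comp_eq_sum_countP (Prod.fst (β := Bool)) (fun _ => 1) (l j)
    simp only [List.map_const', List.sum_replicate, smul_eq_mul, mul_one, hlen] at h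
    rw [Finset.sum_comm]
    simp only [← h, Finset.sum_const, Finset.card_univ, smul_eq_mul, Fintype.card_sum,
      Fintype.card_prod, Fintype.card_fin, ZMod.card, mul_one]
    lia
  have hle : ∀ e ∈ Finset.univ, 1 ≤ ∑ j, (l j).countP (·.1 = e) := by
    intro e _
    obtain ⟨j, hj⟩ := mem e
    obtain ⟨a, ha, rfl⟩ := List.mem_map.1 hj
    exact (List.countP_pos_iff.2 ⟨a, ha, decide_eq_true rfl⟩).trans_le (Finset.single_le_sum
      (f := fun j => (l j).countP (·.1 = a.1)) (fun _ _ => Nat.zero_le _) (Finset.mem_univ j))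
  exact fun e => ((Finset.sum_eq_sum_iff_of_le hle).1 hsum.symm e (Finset.mem_univ e)).symm

theorem hasColumnDecomp_one (hz : 1 < z) : HasColumnDecomp z 1 := by
  have : NeZero z := ⟨by lia⟩
  have : Fact (1 < z) := ⟨hz⟩
  refine ⟨ZMod z, inferInstance, fun h => [(.inl (0, h), true), (.inr (1, h), true),
    (.inl (1, h + 1), true), (.inr (2, h), false), (.inl (2, h), true), (.inr (3, h), true),
    (.inl (3, h + 1), true), (.inr (0, h), false)],
    IsColumnDecomp.of_surjective (by simp) ?_ ?_ ?_ ?_ ?_ ?_⟩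
  · exact fun h => ⟨(0, h), by simp [IsWalk, cylinder, cycleFour]⟩
  · simp [cylinder, cycleFour]
  · intro h i
    fin_cases i <;> simp [cycleFour]
  · simp
  · simp +contextual
  · rintro (⟨i, h⟩ | ⟨i, h⟩)
    · fin_cases i
      exacts [⟨h, by simp⟩, ⟨h - 1, by simp⟩, ⟨h, by simp⟩, ⟨h - 1, by simp⟩]
    · exact ⟨h, by fin_cases i <;> simp⟩

/-- The horizontal dart of `C_4 □ C_z` from `(i, n)` to `(i + 1, n)`. -/
def arc (z : ℕ) (i : Fin 4) (n : ℕ) : ColumnDart z := (.inl (i, n), true)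

/-- The vertical dart of `C_4 □ C_z` from `(i, n)` to `(i, n + 1)`. -/
def up (z : ℕ) (i : Fin 4) (n : ℕ) : ColumnDart z := (.inr (i, n), true)

/-- The vertical dart of `C_4 □ C_z` from `(i, n + 1)` to `(i, n)`. -/
def down (z : ℕ) (i : Fin 4) (n : ℕ) : ColumnDart z := (.inr (i, n), false)

theorem tail_arc (i : Fin 4) (n : ℕ) :
    (cycleFour.cylinder z).tail (arc z i n) = (i, (n : ZMod z)) := rfl

theorem head_arc (i : Fin 4) (n : ℕ) :
    (cycleFour.cylinder z).head (arc z i n) = (i + 1, (n : ZMod z)) := rfl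

theorem tail_up (i : Fin 4) (n : ℕ) :
    (cycleFour.cylinder z).tail (up z i n) = (i, (n : ZMod z)) := rfl

theorem head_up (i : Fin 4) (n : ℕ) :
    (cycleFour.cylinder z).head (up z i n) = (i, ((n + 1 : ℕ) : ZMod z)) :=
  Prod.ext rfl (Nat.cast_succ n).symm

theorem tail_down (i : Fin 4) (n : ℕ) :
    (cycleFour.cylinder z).tail (down z i n) = (i, ((n + 1 : ℕ) : ZMod z)) :=
  Prod.ext rfl (Nat.cast_succ n).symm

theorem head_down (i : Fin 4) (n : ℕ) :
    (cycleFour.cylinder z).head (down z i n) = (i, (n : ZMod z)) := rfl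

/-- The staircase in `C_4 □ C_z` from `(0, n)` once around `C_4` to `(0, n + 3)`. -/
def stairs (z n : ℕ) : List (ColumnDart z) :=
  [arc z 0 n, up z 1 n, arc z 1 (n + 1), up z 2 (n + 1), arc z 2 (n + 2), up z 3 (n + 2),
    arc z 3 (n + 3)]

/-- The eight vertices of the staircase `stairs z n`, with heights in `ℕ`. -/
def stairsVertices (n : ℕ) : List (Fin 4 × ℕ) :=
  [(0, n), (1, n), (1, n + 1), (2, n + 1), (2, n + 2), (3, n + 2), (3, n + 3), (0, n + 3)]

theorem isWalk_stairs (n : ℕ) :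
    (cycleFour.cylinder z).IsWalk (0, (n : ZMod z)) (stairs z n) (0, ((n + 3 : ℕ) : ZMod z)) := by
  simp [stairs, IsWalk, tail_arc, tail_up, head_arc, head_up, add_assoc]

theorem map_tail_stairs_concat {n : ℕ} {a : ColumnDart z}
    (ha : (cycleFour.cylinder z).tail a = (0, ((n + 3 : ℕ) : ZMod z))) :
    (stairs z n ++ [a]).map (cycleFour.cylinder z).tail =
      (stairsVertices n).map (Prod.map id (Nat.cast : ℕ → ZMod z)) := by
  simp [stairs, stairsVertices, tail_arc, tail_up, ha]

/-- The closed walk in `C_4 □ C_{2c}` that starts at `(0, g)` and climbs by two in every turn. -/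
def spiral (z c g : ℕ) : List (ColumnDart z) :=
  (List.range c).flatMap fun k => stairs z (2 * k + g) ++ [down z 0 (2 * k + g + 2)]

theorem isWalk_spiral (hz : 2 * c = z) (g : ℕ) :
    (cycleFour.cylinder z).IsWalk (0, (g : ZMod z)) (spiral z c g) (0, (g : ZMod z)) := by
  have h := isWalk_flatMap_range (G := cycleFour.cylinder z)
    (fun k => ((0 : Fin 4), ((2 * k + g : ℕ) : ZMod z)))
    (fun k => stairs z (2 * k + g) ++ [down z 0 (2 * k + g + 2)]) c fun k _ =>
      (isWalk_stairs _).append ⟨tail_down _ _, (head_down _ _).trans (by grind)⟩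
  simpa [spiral, hz] using h

theorem exists_two_mul_add_eq [NeZero z] (hz : 2 * c = z) {a b : ℕ} (hab : a % 2 ≠ b % 2)
    (y : ZMod z) : ∃ k < c, ((2 * k + a : ℕ) : ZMod z) = y ∨ ((2 * k + b : ℕ) : ZMod z) = y := by
  have hval (o : ℕ) : (((y - o).val + o : ℕ) : ZMod z) = y := by simp
  have hmod : ((y - a).val + a) % 2 = ((y - b).val + b) % 2 :=
    ((ZMod.natCast_eq_natCast_iff _ _ z).1 ((hval a).trans (hval b).symm)).of_dvd ⟨c, hz.symm⟩
  have hlt (o : ℕ) : (y - o).val / 2 < c :=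
    Nat.div_lt_of_lt_mul ((ZMod.val_lt _).trans_eq hz.symm)
  rcases Nat.mod_two_eq_zero_or_one (y - a).val with ha | ha
  · exact ⟨(y - a).val / 2, hlt a, .inl ((congrArg _ (by lia)).trans (hval a))⟩
  · exact ⟨(y - b).val / 2, hlt b, .inr ((congrArg _ (by lia)).trans (hval b))⟩

theorem mem_map_tail_spiral [NeZero z] (hz : 2 * c = z) (g : ℕ) (x : Fin 4 × ZMod z) :
    x ∈ (spiral z c g).map (cycleFour.cylinder z).tail := by
  obtain ⟨i, y⟩ := x
  have h (a b : ℕ) (hab : a % 2 ≠ b % 2) := exists_two_mul_add_eq hz (a := g + a) (b := g + b)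
    (by lia) y
  simp only [spiral, List.map_flatMap, map_tail_stairs_concat (tail_down _ _), stairsVertices,
    List.mem_flatMap, List.mem_range]
  fin_cases i
  · obtain ⟨k, hk, rfl | rfl⟩ := h 0 3 (by decide) <;> exact ⟨k, hk, by simp [add_assoc]⟩
  · obtain ⟨k, hk, rfl | rfl⟩ := h 0 1 (by decide) <;> exact ⟨k, hk, by simp [add_assoc]⟩
  · obtain ⟨k, hk, rfl | rfl⟩ := h 1 2 (by decide) <;> exact ⟨k, hk, by simp [add_assoc]⟩
  · obtain ⟨k, hk, rfl | rfl⟩ := h 2 3 (by decide) <;> exact ⟨k, hk, by simp [add_assoc]⟩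

theorem nodup_map_tail_spiral [NeZero z] (hz : 2 * c = z) (g : ℕ) :
    ((spiral z c g).map (cycleFour.cylinder z).tail).Nodup := by
  -- The spiral is as long as `C_4 □ C_z` has vertices, and it visits them all.
  have huniv : ((spiral z c g).map (cycleFour.cylinder z).tail).toFinset = Finset.univ :=
    Finset.eq_univ_iff_forall.2 fun x => List.mem_toFinset.2 (mem_map_tail_spiral hz g x)
  refine Multiset.toFinset_card_eq_card_iff_nodup.1 ((congrArg Finset.card huniv).trans ?_)
  simp [spiral, stairs, ← hz]
  ring

theorem countP_color_spiral (g : ℕ) (o : Option (Fin 4)) :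
    (spiral z c g).countP ((cycleFour.cylinder z).color ·.1 = o) = o.elim (4 * c) fun _ => c := by
  simp only [spiral, List.countP_flatMap, Function.comp_def]
  rcases o with _ | i
  · simp [stairs, arc, up, down, mul_comm]
  · fin_cases i <;> simp [stairs, arc, up, down, cycleFour]

theorem arc_mem_spiral_iff (g : ℕ) (i : Fin 4) (y : ZMod z) :
    .inl (i, y) ∈ (spiral z c g).map Prod.fst ↔ ∃ k < c, ((2 * k + g + i : ℕ) : ZMod z) = y := by
  simp only [spiral, List.map_flatMap, List.mem_flatMap, List.mem_range]
  refine exists_congr fun k => and_congr_right fun _ => ?_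
  fin_cases i <;> simp [stairs, arc, up, down, eq_comm]

theorem rung_mem_spiral_iff (g : ℕ) (i : Fin 4) (y : ZMod z) :
    .inr (i, y) ∈ (spiral z c g).map Prod.fst ↔
      ∃ k < c, ((2 * k + g + ![2, 0, 1, 2] i : ℕ) : ZMod z) = y := by
  simp only [spiral, List.map_flatMap, List.mem_flatMap, List.mem_range]
  refine exists_congr fun k => and_congr_right fun _ => ?_
  fin_cases i <;> simp [stairs, arc, up, down, eq_comm]

theorem hasColumnDecomp_half (hc : 0 < c) (hz : 2 * c = z) : HasColumnDecomp z c := by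
  have : NeZero z := ⟨by lia⟩
  have hcover (o : ℕ) (y : ZMod z) : ∃ g : Fin 2, ∃ k < c, ((2 * k + g + o : ℕ) : ZMod z) = y := by
    obtain ⟨k, hk, h | h⟩ := exists_two_mul_add_eq hz (a := 0 + o) (b := 1 + o) (by lia) y
    · exact ⟨0, k, hk, (congrArg _ (by simp)).trans h⟩
    · exact ⟨1, k, hk, (congrArg _ (by simp [add_assoc])).trans h⟩
  refine ⟨Fin 2, inferInstance, fun g => spiral z c g, IsColumnDecomp.of_surjective
    (by simpa using hz) (fun g => ⟨_, isWalk_spiral hz g⟩) (fun g => nodup_map_tail_spiral hz g)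
    (fun g i => countP_color_spiral g (some i)) (fun g => countP_color_spiral g none) ?_ ?_⟩
  · intro g y h h'
    obtain ⟨k, -, rfl⟩ := (arc_mem_spiral_iff _ _ _).1 h
    obtain ⟨k', -, hk'⟩ := (arc_mem_spiral_iff _ _ _).1 h'
    have hmod : (2 * k' + g + 0) % 2 = (2 * k + g + 0 + 1) % 2 :=
      ((ZMod.natCast_eq_natCast_iff _ _ z).1 (hk'.trans (Nat.cast_succ _).symm)).of_dvd ⟨c, hz.symm⟩
    lia
  · rintro (⟨i, y⟩ | ⟨i, y⟩)
    · simpa only [arc_mem_spiral_iff] using hcover i y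
    · simpa only [rung_mem_spiral_iff] using hcover (![2, 0, 1, 2] i) y

end Columns

end ColoredGraph

theorem flatMap_range_two_mul_add_one_perm {α : Type*} (g : ℕ → List α) (n : ℕ) :
    ((List.range (n + 1)).flatMap (fun k => g (2 * k)) ++
      (List.range n).flatMap fun k => g (2 * k + 1)).Perm ((List.range (2 * n + 1)).flatMap g) := by
  induction n with
  | zero => simp
  | succ n ih =>
    have h := Multiset.coe_eq_coe.2 (ih.append_right (g (2 * n + 1) ++ g (2 * n + 2)))
    rw [List.range_succ (n := n), List.range_succ (n := n + 1), ← Multiset.coe_eq_coe,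
      show 2 * (n + 1) + 1 = 2 * n + 1 + 1 + 1 by ring,
      List.range_succ (n := 2 * n + 1 + 1), List.range_succ (n := 2 * n + 1)]
    simp only [List.flatMap_append, List.flatMap_singleton, List.append_assoc, ← Multiset.coe_add,
      mul_add, mul_one, add_assoc, Nat.reduceAdd] at h ⊢
    rw [← h]
    abel

namespace ColoredGraph

section Helix

variable {z : ℕ}

/-- The staircase in `C_4 □ C_z` from `(0, n)` once around `C_4` to `(0, n + 4)`. -/
def helixTurn (z n : ℕ) : List (ColumnDart z) := stairs z n ++ [up z 0 (n + 3)]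

/-- The first strand of `helix`, from `(0, 0)` to `(0, 4 * f + 4)`. -/
def helixOne (z f : ℕ) : List (ColumnDart z) :=
  (List.range (f + 1)).flatMap fun k => helixTurn z (4 * k)

/-- The second strand of `helix`, from `(0, 0)` to `(0, 4 * f + 4)`. -/
def helixTwo (z f : ℕ) : List (ColumnDart z) :=
  [up z 0 0, up z 0 1] ++ (List.range f).flatMap (fun k => helixTurn z (4 * k + 2)) ++
    [arc z 0 (4 * f + 2), up z 1 (4 * f + 2), arc z 1 (4 * f + 3), up z 2 (4 * f + 3),
      arc z 2 (4 * f + 4), arc z 3 (4 * f + 4)]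

/-- The closed walk in `C_4 □ C_z` consisting of two strands which wind around `C_4` in parallel,
one climbing from height `0` to height `4 * f + 4` and the other descending. -/
def helix (z f : ℕ) : List (ColumnDart z) := helixOne z f ++ revWalk (helixTwo z f)

/-- The darts of the two strands of `helix` that do not belong to a full turn. -/
def helixEnds (z f : ℕ) : List (ColumnDart z) :=
  [up z 0 0, up z 0 1, arc z 0 (4 * f + 2), up z 1 (4 * f + 2), arc z 1 (4 * f + 3),
    up z 2 (4 * f + 3), arc z 2 (4 * f + 4), arc z 3 (4 * f + 4)]

/-- The vertices of `helix`, with heights in `ℕ`. -/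
def helixVertices (f : ℕ) : List (Fin 4 × ℕ) :=
  (List.range (2 * f + 1)).flatMap (fun j => stairsVertices (2 * j)) ++
    [(0, 1), (0, 4 * f + 2), (1, 4 * f + 2), (1, 4 * f + 3), (2, 4 * f + 3), (2, 4 * f + 4),
      (3, 4 * f + 4), (0, 4 * f + 4)]

theorem isWalk_helixTurn (n : ℕ) :
    (cycleFour.cylinder z).IsWalk (0, (n : ZMod z)) (helixTurn z n)
      (0, ((n + 4 : ℕ) : ZMod z)) :=
  (isWalk_stairs n).append ⟨tail_up _ _, head_up _ _⟩

theorem isWalk_helixOne (f : ℕ) :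
    (cycleFour.cylinder z).IsWalk (0, 0) (helixOne z f) (0, ((4 * f + 4 : ℕ) : ZMod z)) := by
  have h := isWalk_flatMap_range (G := cycleFour.cylinder z)
    (fun k => ((0 : Fin 4), ((4 * k : ℕ) : ZMod z))) (fun k => helixTurn z (4 * k)) (f + 1)
    fun k _ => isWalk_helixTurn _
  simpa [mul_add, helixOne] using h

theorem isWalk_helixTwo (f : ℕ) :
    (cycleFour.cylinder z).IsWalk (0, 0) (helixTwo z f) (0, ((4 * f + 4 : ℕ) : ZMod z)) := by
  have h := isWalk_flatMap_range (G := cycleFour.cylinder z)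
    (fun k => ((0 : Fin 4), ((4 * k + 2 : ℕ) : ZMod z))) (fun k => helixTurn z (4 * k + 2)) f
    fun k _ => isWalk_helixTurn _
  refine (IsWalk.append (v := (0, ((4 * 0 + 2 : ℕ) : ZMod z))) ?_ h).append ?_ <;>
    simp [IsWalk, tail_up, head_up, tail_arc, head_arc, add_assoc]

theorem isWalk_helix (f : ℕ) : (cycleFour.cylinder z).IsWalk (0, 0) (helix z f) (0, 0) :=
  (isWalk_helixOne f).append (isWalk_helixTwo f).reverse

theorem helixOne_append_helixTwo_perm (f : ℕ) :
    (helixOne z f ++ helixTwo z f).Perm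
      ((List.range (2 * f + 1)).flatMap (fun j => helixTurn z (2 * j)) ++ helixEnds z f) := by
  refine .trans ?_ ((flatMap_range_two_mul_add_one_perm (fun j => helixTurn z (2 * j))
    f).append_right _)
  rw [← Multiset.coe_eq_coe]
  simp only [helixOne, helixTwo, helixEnds, ← Multiset.coe_add, ← mul_assoc, mul_add, mul_one,
    Nat.reduceMul, ← Multiset.cons_coe, Multiset.coe_nil]
  simp only [← Multiset.singleton_add]
  abel

theorem map_fst_helix_perm (f : ℕ) :
    ((helix z f).map Prod.fst).Perm
      (((List.range (2 * f + 1)).flatMap (fun j => helixTurn z (2 * j)) ++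
        helixEnds z f).map Prod.fst) := by
  refine .trans ?_ ((helixOne_append_helixTwo_perm f).map _)
  simpa only [helix, List.map_append] using (map_fst_revWalk _).append_left _

theorem map_tail_helix_perm (f : ℕ) :
    ((helix z f).map (cycleFour.cylinder z).tail).Perm
      ((helixVertices f).map (Prod.map id (Nat.cast : ℕ → ZMod z))) := by
  have hturn (n : ℕ) : (helixTurn z n).map (cycleFour.cylinder z).tail =
      (stairsVertices n).map (Prod.map id (Nat.cast : ℕ → ZMod z)) :=
    map_tail_stairs_concat (tail_up _ _)
  have hheads := congrArg Multiset.ofList (isWalk_helixTwo (z := z) f).map_tail_append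
  have hperm := Multiset.coe_eq_coe.2
    ((helixOne_append_helixTwo_perm (z := z) f).map (cycleFour.cylinder z).tail)
  rw [← Multiset.coe_eq_coe, ← Multiset.cons_inj_right (0, 0)]
  simp only [List.map_append, List.map_flatMap, hturn, ← Multiset.coe_add, ← Multiset.cons_coe,
    Multiset.coe_nil] at hheads hperm
  have htails : ((0, 0) : Fin 4 × ZMod z) ::ₘ ↑((helix z f).map (cycleFour.cylinder z).tail) =
      ↑((helixOne z f).map (cycleFour.cylinder z).tail) +
        (↑((helixTwo z f).map (cycleFour.cylinder z).tail) +
          {(0, ((4 * f + 4 : ℕ) : ZMod z))}) := by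
    rw [← Multiset.cons_zero, hheads, helix, List.map_append, map_tail_revWalk,
      ← Multiset.coe_add, Multiset.coe_reverse, Multiset.add_cons]
  rw [htails, ← add_assoc, hperm, helixVertices, List.map_append, List.map_flatMap,
    ← Multiset.coe_add, add_assoc, ← Multiset.add_cons, ← Multiset.coe_singleton, Multiset.coe_add,
    Multiset.cons_coe]
  simp [helixEnds, tail_arc, tail_up]

theorem nodup_helixVertices (f : ℕ) : (helixVertices f).Nodup := by
  refine List.nodup_append'.2 ⟨List.nodup_flatMap.2 ⟨fun j _ => by simp [stairsVertices], ?_⟩,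
    by simp, ?_⟩
  · refine List.nodup_range.imp fun {j j'} hne => ?_
    rintro ⟨i, m⟩ h h'
    fin_cases i <;> simp [stairsVertices] at h h' <;> lia
  · rintro ⟨i, m⟩ h h'
    fin_cases i <;> simp [stairsVertices] at h h' <;> grind

theorem lt_of_mem_helixVertices {f : ℕ} {x : Fin 4 × ℕ} (hx : x ∈ helixVertices f) :
    x.2 < 4 * f + 5 := by
  simp [helixVertices, stairsVertices] at hx
  grind

theorem nodup_map_tail_helix {f : ℕ} (hz : 4 * f + 4 < z) :
    ((helix z f).map (cycleFour.cylinder z).tail).Nodup := by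
  refine (map_tail_helix_perm f).nodup_iff.2
    ((nodup_helixVertices f).map_on fun x hx y hy hxy => ?_)
  obtain ⟨h₁, h₂⟩ := Prod.ext_iff.1 hxy
  exact Prod.ext h₁ (((ZMod.natCast_eq_natCast_iff _ _ z).1 h₂).eq_of_lt_of_lt
    ((lt_of_mem_helixVertices hx).trans_le hz) ((lt_of_mem_helixVertices hy).trans_le hz))

theorem countP_color_helix (f : ℕ) (o : Option (Fin 4)) :
    (helix z f).countP ((cycleFour.cylinder z).color ·.1 = o) =
      o.elim (4 * (2 * f + 2)) fun _ => 2 * f + 2 := by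
  have h := (map_fst_helix_perm (z := z) f).countP_eq ((cycleFour.cylinder z).color · = o)
  simp only [List.countP_map, Function.comp_def] at h
  rw [h, List.countP_append, List.countP_flatMap]
  rcases o with _ | i
  · simp [Function.comp_def, helixTurn, helixEnds, stairs, arc, up]
    ring
  · fin_cases i <;> simp [Function.comp_def, helixTurn, helixEnds, stairs, arc, up, cycleFour]

theorem arc_mem_helix_iff {f : ℕ} {i : Fin 4} {y : ZMod z} :
    .inl (i, y) ∈ (helix z f).map Prod.fst ↔ (∃ j ≤ 2 * f, ((2 * j + i : ℕ) : ZMod z) = y) ∨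
      ((4 * f + ![2, 3, 4, 4] i : ℕ) : ZMod z) = y := by
  rw [(map_fst_helix_perm f).mem_iff, List.map_append, List.mem_append, List.map_flatMap,
    List.mem_flatMap]
  refine or_congr (exists_congr fun j => and_congr (by simp) ?_) ?_ <;>
    fin_cases i <;> simp [helixTurn, helixEnds, stairs, arc, up, eq_comm]

theorem rung_mem_helix_iff {f : ℕ} {i : Fin 4} {y : ZMod z} :
    .inr (i, y) ∈ (helix z f).map Prod.fst ↔
      (∃ j ≤ 2 * f, ((2 * j + ![3, 0, 1, 2] i : ℕ) : ZMod z) = y) ∨ i = 0 ∧ (y = 0 ∨ y = 1) ∨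
        i = 1 ∧ y = (4 * f + 2 : ℕ) ∨ i = 2 ∧ y = (4 * f + 3 : ℕ) := by
  rw [(map_fst_helix_perm f).mem_iff, List.map_append, List.mem_append, List.map_flatMap,
    List.mem_flatMap]
  refine or_congr (exists_congr fun j => and_congr (by simp) ?_) ?_ <;>
    fin_cases i <;> simp [helixTurn, helixEnds, stairs, arc, up, eq_comm]

theorem helix_arc_cover (f : ℕ) (i : Fin 4) {m : ℕ} (h : ![0, 1, 2, 1] i ≤ m)
    (h' : m < 4 * f + 4 + ![0, 1, 2, 1] i) :
    .inl (i, (m : ZMod z)) ∈ (helix z f).map Prod.fst ∨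
      .inl (2 - i, ((4 * f + 5 - m : ℕ) : ZMod z)) ∈ (helix z f).map Prod.fst := by
  have hmem {i : Fin 4} {m : ℕ} (h : (m % 2 = i.1 % 2 ∧ i.1 ≤ m ∧ m ≤ 4 * f + i) ∨
      m = 4 * f + ![2, 3, 4, 4] i) : .inl (i, (m : ZMod z)) ∈ (helix z f).map Prod.fst :=
    arc_mem_helix_iff.2 (h.imp (fun h => ⟨(m - i) / 2, by lia, congrArg _ (by lia)⟩)
      fun h => congrArg _ h.symm)
  refine Or.imp hmem hmem ?_
  fin_cases i <;> simp at h h' ⊢ <;> lia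

theorem helix_rung_cover (f : ℕ) (i : Fin 4) {m : ℕ} (h : ![0, 0, 1, 1] i ≤ m)
    (h' : m < 4 * f + 4 + ![0, 0, 1, 1] i) :
    .inr (i, (m : ZMod z)) ∈ (helix z f).map Prod.fst ∨
      .inr (3 - i, ((4 * f + 4 - m : ℕ) : ZMod z)) ∈ (helix z f).map Prod.fst := by
  have hmem {i : Fin 4} {m : ℕ} (h : (m % 2 = ![3, 0, 1, 2] i % 2 ∧ ![3, 0, 1, 2] i ≤ m ∧
      m ≤ 4 * f + ![3, 0, 1, 2] i) ∨ i = 0 ∧ (m = 0 ∨ m = 1) ∨ i = 1 ∧ m = 4 * f + 2 ∨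
        i = 2 ∧ m = 4 * f + 3) : .inr (i, (m : ZMod z)) ∈ (helix z f).map Prod.fst := by
    rcases h with h | ⟨rfl, rfl | rfl⟩ | ⟨rfl, rfl⟩ | ⟨rfl, rfl⟩
    · exact rung_mem_helix_iff.2
        (.inl ⟨(m - ![3, 0, 1, 2] i) / 2, by lia, congrArg _ (by lia)⟩)
    all_goals exact rung_mem_helix_iff.2 (.inr (by simp))
  refine Or.imp hmem hmem ?_
  fin_cases i <;> simp at h h' ⊢ <;> lia

/-- Translation of the darts of `C_4 □ C_z` by `k` in the direction of `C_z`. -/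
def shiftDart (k : ZMod z) : ColumnDart z → ColumnDart z
  | (.inl (i, h), b) => (.inl (i, k + h), b)
  | (.inr (i, h), b) => (.inr (i, k + h), b)

/-- The point reflection `(i, h) ↦ (3 - i, k - h)` on the darts of `C_4 □ C_z`. -/
def flipDart (k : ZMod z) : ColumnDart z → ColumnDart z
  | (.inl (i, h), b) => (.inl (2 - i, k - h), !b)
  | (.inr (i, h), b) => (.inr (3 - i, k - (h + 1)), !b)

theorem isDartHom_shiftDart (k : ZMod z) :
    IsDartHom (cycleFour.cylinder z) (cycleFour.cylinder z) (Prod.map id (k + ·))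
      (shiftDart k) where
  tail := by
    rintro ⟨⟨i, h⟩ | ⟨i, h⟩, _ | _⟩ <;> simp [shiftDart, cylinder, cycleFour, add_assoc]
  head := by
    rintro ⟨⟨i, h⟩ | ⟨i, h⟩, _ | _⟩ <;> simp [shiftDart, cylinder, cycleFour, add_assoc]

theorem isDartHom_flipDart (k : ZMod z) :
    IsDartHom (cycleFour.cylinder z) (cycleFour.cylinder z) (Prod.map (3 - ·) (k - ·))
      (flipDart k) where
  tail := by
    rintro ⟨⟨i, h⟩ | ⟨i, h⟩, _ | _⟩ <;> simp [flipDart, cylinder, cycleFour] <;> grind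
  head := by
    rintro ⟨⟨i, h⟩ | ⟨i, h⟩, _ | _⟩ <;> simp [flipDart, cylinder, cycleFour] <;> grind

theorem color_shiftDart (k : ZMod z) (a : ColumnDart z) :
    (cycleFour.cylinder z).color (shiftDart k a).1 = (cycleFour.cylinder z).color a.1 := by
  rcases a with ⟨⟨i, h⟩ | ⟨i, h⟩, _⟩ <;> rfl

theorem color_flipDart (k : ZMod z) (a : ColumnDart z) :
    (cycleFour.cylinder z).color (flipDart k a).1 =
      ((cycleFour.cylinder z).color a.1).map (2 - ·) := by
  rcases a with ⟨⟨i, h⟩ | ⟨i, h⟩, _⟩ <;> rfl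

theorem two_mul_add_one_ne_two_mul (hz : Even z) (a b : ℕ) :
    ((2 * a : ℕ) : ZMod z) + 1 ≠ ((2 * b : ℕ) : ZMod z) := by
  intro h
  have hmod : (2 * a + 1) % 2 = (2 * b) % 2 :=
    ((ZMod.natCast_eq_natCast_iff _ _ z).1 ((Nat.cast_succ _).trans h)).of_dvd hz.two_dvd
  lia

theorem exists_natCast_two_mul_of_arc_mem_helix {f : ℕ} {y : ZMod z} {i : Fin 4}
    (hi : i = 0 ∨ i = 2) (hy : .inl (i, y) ∈ (helix z f).map Prod.fst) :
    ∃ m : ℕ, ((2 * m : ℕ) : ZMod z) = y := by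
  obtain ⟨j, -, rfl⟩ | rfl := arc_mem_helix_iff.1 hy
  · rcases hi with rfl | rfl
    exacts [⟨j, rfl⟩, ⟨j + 1, rfl⟩]
  · rcases hi with rfl | rfl
    exacts [⟨2 * f + 1, congrArg _ (by simp; ring)⟩, ⟨2 * f + 2, congrArg _ (by simp; ring)⟩]

theorem arc_mem_map_shiftDart_iff {l : List (ColumnDart z)} {k y : ZMod z} {i : Fin 4} :
    .inl (i, y) ∈ (l.map (shiftDart k)).map Prod.fst ↔ .inl (i, y - k) ∈ l.map Prod.fst := by
  have h (a : ColumnDart z) : (shiftDart k a).1 = .inl (i, y) ↔ a.1 = .inl (i, y - k) := by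
    rcases a with ⟨⟨_, _⟩ | ⟨_, _⟩, _⟩ <;> simp [shiftDart, eq_sub_iff_add_eq']
  simp only [List.mem_map, exists_exists_and_eq_and, h]

theorem rung_mem_map_shiftDart_iff {l : List (ColumnDart z)} {k y : ZMod z} {i : Fin 4} :
    .inr (i, y) ∈ (l.map (shiftDart k)).map Prod.fst ↔ .inr (i, y - k) ∈ l.map Prod.fst := by
  have h (a : ColumnDart z) : (shiftDart k a).1 = .inr (i, y) ↔ a.1 = .inr (i, y - k) := by
    rcases a with ⟨⟨_, _⟩ | ⟨_, _⟩, _⟩ <;> simp [shiftDart, eq_sub_iff_add_eq']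
  simp only [List.mem_map, exists_exists_and_eq_and, h]

theorem arc_mem_map_flipDart_iff {l : List (ColumnDart z)} {k y : ZMod z} {i : Fin 4} :
    .inl (i, y) ∈ (l.map (flipDart k)).map Prod.fst ↔ .inl (2 - i, k - y) ∈ l.map Prod.fst := by
  have h (a : ColumnDart z) : (flipDart k a).1 = .inl (i, y) ↔ a.1 = .inl (2 - i, k - y) := by
    rcases a with ⟨⟨_, _⟩ | ⟨_, _⟩, _⟩ <;> simp [flipDart]
    grind
  simp only [List.mem_map, exists_exists_and_eq_and, h]

theorem rung_mem_map_flipDart_iff {l : List (ColumnDart z)} {k y : ZMod z} {i : Fin 4} :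
    .inr (i, y) ∈ (l.map (flipDart k)).map Prod.fst ↔
      .inr (3 - i, k - (y + 1)) ∈ l.map Prod.fst := by
  have h (a : ColumnDart z) : (flipDart k a).1 = .inr (i, y) ↔ a.1 = .inr (3 - i, k - (y + 1)) := by
    rcases a with ⟨⟨_, _⟩ | ⟨_, _⟩, _⟩ <;> simp [flipDart]
    grind
  simp only [List.mem_map, exists_exists_and_eq_and, h]

theorem exists_natCast_mul_add_eq [NeZero z] {M q : ℕ} (hM : 0 < M) (hz : M * q = z) (s : ℕ)
    (y : ZMod z) :
    ∃ k : Fin q, ∃ m : ℕ, s ≤ m ∧ m < M + s ∧ ((M * k : ℕ) : ZMod z) + (m : ℕ) = y := by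
  refine ⟨⟨(y - s).val / M, Nat.div_lt_of_lt_mul ((ZMod.val_lt _).trans_eq hz.symm)⟩,
    (y - s).val % M + s, Nat.le_add_left _ _, Nat.add_lt_add_right (Nat.mod_lt _ hM) s, ?_⟩
  rw [← Nat.cast_add, ← add_assoc, Nat.div_add_mod, Nat.cast_add, ZMod.natCast_zmod_val,
    sub_add_cancel]

/-- The copies of `helix` that decompose `C_4 □ C_z`: the translates by multiples of the height of
`helix`, and their images under point reflections. -/
def helixCopy (z f : ℕ) : Bool × ℕ → List (ColumnDart z)
  | (false, k) => (helix z f).map (shiftDart ((4 * f + 4) * k : ℕ))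
  | (true, k) => (helix z f).map (flipDart ((4 * f + 4) * k + (4 * f + 5) : ℕ))

theorem isWalk_helixCopy (f : ℕ) (j : Bool × ℕ) :
    ∃ u, (cycleFour.cylinder z).IsWalk u (helixCopy z f j) u := by
  rcases j with ⟨_ | _, k⟩
  · exact ⟨_, (isWalk_helix f).map (isDartHom_shiftDart _)⟩
  · exact ⟨_, (isWalk_helix f).map (isDartHom_flipDart _)⟩

theorem nodup_map_tail_helixCopy {f : ℕ} (hz : 4 * f + 4 < z) (j : Bool × ℕ) :
    ((helixCopy z f j).map (cycleFour.cylinder z).tail).Nodup := by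
  rcases j with ⟨_ | _, k⟩
  · exact (isDartHom_shiftDart _).nodup_map_tail
      (Function.injective_id.prodMap (add_right_injective _)) (nodup_map_tail_helix hz)
  · exact (isDartHom_flipDart _).nodup_map_tail
      (sub_right_injective.prodMap sub_right_injective) (nodup_map_tail_helix hz)

theorem countP_color_helixCopy (f : ℕ) (j : Bool × ℕ) (o : Option (Fin 4)) :
    (helixCopy z f j).countP ((cycleFour.cylinder z).color ·.1 = o) =
      o.elim (4 * (2 * f + 2)) fun _ => 2 * f + 2 := by
  rcases j with ⟨_ | _, k⟩
  · simp only [helixCopy, List.countP_map, Function.comp_def, color_shiftDart,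
      countP_color_helix]
  · have h (o o' : Option (Fin 4)) : o'.map (2 - ·) = o ↔ o' = o.map (2 - ·) := by
      rcases o with _ | i <;> rcases o' with _ | i' <;> simp
      grind
    simp only [helixCopy, List.countP_map, Function.comp_def, color_flipDart, h,
      countP_color_helix]
    cases o <;> rfl

theorem not_adj_helixCopy {f : ℕ} (hz : Even z) (j : Bool × ℕ) (y : ZMod z)
    (h : .inl (0, y) ∈ (helixCopy z f j).map Prod.fst) :
    .inl (0, y + 1) ∉ (helixCopy z f j).map Prod.fst := by
  intro h'
  rcases j with ⟨_ | _, k⟩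
  · simp only [helixCopy, arc_mem_map_shiftDart_iff] at h h'
    obtain ⟨a, ha⟩ := exists_natCast_two_mul_of_arc_mem_helix (.inl rfl) h
    obtain ⟨b, hb⟩ := exists_natCast_two_mul_of_arc_mem_helix (.inl rfl) h'
    exact two_mul_add_one_ne_two_mul hz a b (by rw [ha, hb]; ring)
  · simp only [helixCopy, arc_mem_map_flipDart_iff] at h h'
    obtain ⟨a, ha⟩ := exists_natCast_two_mul_of_arc_mem_helix (.inr rfl) h
    obtain ⟨b, hb⟩ := exists_natCast_two_mul_of_arc_mem_helix (.inr rfl) h'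
    exact two_mul_add_one_ne_two_mul hz b a (by rw [ha, hb]; ring)

theorem exists_mem_helixCopy [NeZero z] {f q : ℕ} (hz : (4 * f + 4) * q = z)
    (e : (Fin 4 × ZMod z) ⊕ (Fin 4 × ZMod z)) :
    ∃ j : Bool × Fin q, e ∈ (helixCopy z f (j.1, j.2)).map Prod.fst := by
  have hcover (s : ℕ) (y : ZMod z) :=
    exists_natCast_mul_add_eq (M := 4 * f + 4) (Nat.succ_pos _) hz s y
  rcases e with ⟨i, y⟩ | ⟨i, y⟩
  · obtain ⟨k, m, hm, hm', rfl⟩ := hcover (![0, 1, 2, 1] i) y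
    have hle : m ≤ 4 * f + 5 := by fin_cases i <;> simp at hm' <;> lia
    rcases helix_arc_cover (z := z) f i hm hm' with h | h
    · exact ⟨(false, k), arc_mem_map_shiftDart_iff.2 (by rwa [add_sub_cancel_left])⟩
    · refine ⟨(true, k), arc_mem_map_flipDart_iff.2 ?_⟩
      convert h using 3
      rw [Nat.cast_sub hle]
      push_cast
      ring
  · obtain ⟨k, m, hm, hm', rfl⟩ := hcover (![0, 0, 1, 1] i) y
    have hle : m ≤ 4 * f + 4 := by fin_cases i <;> simp at hm' <;> lia
    rcases helix_rung_cover (z := z) f i hm hm' with h | h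
    · exact ⟨(false, k), rung_mem_map_shiftDart_iff.2 (by rwa [add_sub_cancel_left])⟩
    · refine ⟨(true, k), rung_mem_map_flipDart_iff.2 ?_⟩
      convert h using 3
      rw [Nat.cast_sub hle]
      push_cast
      ring

theorem hasColumnDecomp_even {c : ℕ} (hc : 0 < c) (hc' : Even c) (hcz : 2 * c ∣ z)
    (hlt : 2 * c < z) : HasColumnDecomp z c := by
  have : NeZero z := ⟨by lia⟩
  obtain ⟨q, hq⟩ := hcz
  obtain ⟨f, rfl⟩ : ∃ f, c = 2 * f + 2 := ⟨c / 2 - 1, by grind⟩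
  have hz : (4 * f + 4) * q = z := by rw [hq]; ring
  have heven : Even z := ⟨(2 * f + 2) * q, by rw [← hz]; ring⟩
  exact ⟨Bool × Fin q, inferInstance, fun j => helixCopy z f (j.1, j.2),
    IsColumnDecomp.of_surjective (by simp [hq]; ring) (fun _ => isWalk_helixCopy f _)
      (fun _ => nodup_map_tail_helixCopy (by lia) _)
      (fun _ i => countP_color_helixCopy f _ (some i))
      (fun _ => countP_color_helixCopy f _ none) (fun _ => not_adj_helixCopy heven _)
      (exists_mem_helixCopy hz)⟩

theorem hasColumnDecomp {c : ℕ} (hz : 1 < z) (hcz : 2 * c ∣ z)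
    (h : c = 1 ∨ Even c ∨ 2 * c = z) : HasColumnDecomp z c := by
  have hc : 0 < c := by
    have := Nat.pos_of_dvd_of_pos hcz (by lia)
    lia
  rcases h with rfl | h | h
  · exact hasColumnDecomp_one hz
  · rcases (Nat.le_of_dvd (by lia) hcz).eq_or_lt with h' | h'
    exacts [hasColumnDecomp_half hc h', hasColumnDecomp_even hc h hcz h']
  · exact hasColumnDecomp_half hc h

end Helix

end ColoredGraph

namespace ColoredGraph

section Map

variable {V E ι V' E' ι' : Type*} {G : ColoredGraph V E ι} {G' : ColoredGraph V' E' ι'}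
  {φ : V → V'} {ψ : E → E'}

theorem isDartHom_prodMap (hsrc : ∀ e, G'.src (ψ e) = φ (G.src e))
    (htgt : ∀ e, G'.tgt (ψ e) = φ (G.tgt e)) : IsDartHom G G' φ (Prod.map ψ id) where
  tail := by
    rintro ⟨e, _ | _⟩
    exacts [htgt e, hsrc e]
  head := by
    rintro ⟨e, _ | _⟩
    exacts [hsrc e, htgt e]

variable [DecidableEq E] [DecidableEq ι] [DecidableEq E'] [DecidableEq ι']

theorem HasBalancedDecomp.map {σ : ι → ι'} {R : ℕ} (h : G.HasBalancedDecomp R)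
    (hφ : φ.Injective) (hψ : ψ.Bijective) (hσ : σ.Bijective)
    (hsrc : ∀ e, G'.src (ψ e) = φ (G.src e)) (htgt : ∀ e, G'.tgt (ψ e) = φ (G.tgt e))
    (hcolor : ∀ e, G'.color (ψ e) = σ (G.color e)) : G'.HasBalancedDecomp R := by
  obtain ⟨J, _, l, hl, hR⟩ := h
  have hhom := isDartHom_prodMap hsrc htgt
  refine ⟨J, inferInstance, fun j => (l j).map (Prod.map ψ id), ⟨fun j => ?_, fun j =>
    hhom.nodup_map_tail hφ (hl.nodup j), fun e' => ?_⟩, fun j i' => ?_⟩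
  · obtain ⟨u, hu⟩ := hl.closed j
    exact ⟨φ u, hu.map hhom⟩
  · obtain ⟨e, rfl⟩ := hψ.2 e'
    simpa only [List.countP_map, Function.comp_def, Prod.map_fst, hψ.1.eq_iff] using hl.cover e
  · obtain ⟨i, rfl⟩ := hσ.2 i'
    simpa only [List.countP_map, Function.comp_def, Prod.map_fst, hcolor, hσ.1.eq_iff] using hR j i

end Map

section Torus

variable {κ : Type*} [DecidableEq κ]

/-- The product of the cycles `C_{n i}`, coloured by the factors; it describes the edges of
`LockKey.torus` for an arbitrary index type. -/
def torusGraph (n : κ → ℕ) : ColoredGraph (∀ i, ZMod (n i)) ((∀ i, ZMod (n i)) × κ) κ where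
  src := Prod.fst
  tgt e := Function.update e.1 e.2 (e.1 e.2 + 1)
  color := Prod.snd

theorem isDiregular_torusGraph [Fintype κ] (n : κ → ℕ) [∀ i, NeZero (n i)] :
    (torusGraph n).IsDiregular (Fintype.card κ) where
  card_src v := by
    rw [← Finset.card_univ]
    refine (Finset.card_bij (fun i _ => (v, i))
      (fun i _ => Finset.mem_filter.2 ⟨Finset.mem_univ _, rfl⟩)
      (fun i _ j _ h => congrArg Prod.snd h) ?_).symm
    rintro ⟨w, i⟩ hw
    obtain rfl : w = v := (Finset.mem_filter.1 hw).2
    exact ⟨i, Finset.mem_univ _, rfl⟩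
  card_tgt v := by
    rw [← Finset.card_univ]
    refine (Finset.card_bij (fun i _ => (Function.update v i (v i - 1), i))
      (fun i _ => Finset.mem_filter.2 ⟨Finset.mem_univ _, by simp [torusGraph]⟩)
      (fun i _ j _ h => congrArg Prod.snd h) ?_).symm
    rintro ⟨w, i⟩ hw
    obtain rfl : (torusGraph n).tgt (w, i) = v := (Finset.mem_filter.1 hw).2
    exact ⟨i, Finset.mem_univ _, by simp [torusGraph]⟩

theorem HasBalancedDecomp.torusGraph_reindex {κ' : Type*} [DecidableEq κ'] [Fintype κ]
    [Fintype κ'] {n : κ → ℕ} {n' : κ' → ℕ} {R : ℕ} (h : (torusGraph n).HasBalancedDecomp R)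
    (f : κ ≃ κ') (hn : ∀ i, n' (f i) = n i) : (torusGraph n').HasBalancedDecomp R := by
  obtain rfl : (fun i => n' (f i)) = n := funext hn
  let φ := Equiv.piCongrLeft (fun i => ZMod (n' i)) f
  have hφ (x : ∀ i, ZMod (n' (f i))) (i : κ) : φ x (f i) = x i :=
    Equiv.piCongrLeft_apply_apply (fun i => ZMod (n' i)) f x i
  refine h.map (ψ := Prod.map φ f) φ.injective (φ.prodCongr f).bijective f.bijective
    (fun _ => rfl) ?_ (fun _ => rfl)
  rintro ⟨x, i⟩
  funext j
  obtain ⟨j, rfl⟩ := f.surjective j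
  simp only [torusGraph, Prod.map_apply, hφ]
  by_cases hij : j = i
  · subst hij
    simp only [Function.update_self]
  · rw [Function.update_of_ne hij, Function.update_of_ne fun h => hij (f.injective h), hφ]

theorem HasBalancedDecomp.torusGraph_option [Fintype κ] {n : κ → ℕ} {n' : Option κ → ℕ} {z R : ℕ}
    (h : ((torusGraph n).cylinder z).HasBalancedDecomp R) (hz : n' none = z)
    (hn : ∀ i, n' (some i) = n i) : (torusGraph n').HasBalancedDecomp R := by
  subst hz
  obtain rfl : (fun i => n' (some i)) = n := funext hn
  let φ : (∀ i, ZMod (n' (some i))) × ZMod (n' none) ≃ ∀ o, ZMod (n' o) :=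
    { toFun x := fun
        | none => x.2
        | some i => x.1 i
      invFun x := (fun i => x (some i), x none)
      left_inv _ := rfl
      right_inv x := funext fun
        | none => rfl
        | some _ => rfl }
  let ψ : ((∀ i, ZMod (n' (some i))) × κ) × ZMod (n' none) ⊕
      (∀ i, ZMod (n' (some i))) × ZMod (n' none) → (∀ o, ZMod (n' o)) × Option κ :=
    Sum.elim (fun p => (φ (p.1.1, p.2), some p.1.2)) fun p => (φ p, none)
  have hψ : ψ.Bijective := by
    refine ⟨?_, ?_⟩
    · rintro (⟨⟨x, i⟩, a⟩ | p) (⟨⟨y, j⟩, b⟩ | q) hpq <;> simp_all [ψ]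
    · rintro ⟨w, _ | i⟩ <;> obtain ⟨x, rfl⟩ := φ.surjective w
      exacts [⟨.inr x, rfl⟩, ⟨.inl ((x.1, i), x.2), rfl⟩]
  have hcolor : ∀ p, (torusGraph n').color (ψ p) =
      id (((torusGraph fun i => n' (some i)).cylinder (n' none)).color p) := by
    rintro (p | p) <;> rfl
  refine h.map φ.injective hψ Function.bijective_id ?_ ?_ hcolor
  · rintro (p | p) <;> rfl
  · rintro (⟨⟨x, i⟩, a⟩ | ⟨x, a⟩) <;> funext o <;> rcases o with _ | j
    · simp [torusGraph, ColoredGraph.cylinder, ψ, φ]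
    · by_cases hij : j = i
      · subst hij
        simp [torusGraph, ColoredGraph.cylinder, ψ, φ]
      · simp [torusGraph, ColoredGraph.cylinder, ψ, φ, Function.update_of_ne, hij]
    · simp [torusGraph, ColoredGraph.cylinder, ψ, φ]
    · simp [torusGraph, ColoredGraph.cylinder, ψ, φ]

theorem hasBalancedDecomp_torusGraph_unique [Unique κ] (n : κ → ℕ) (hn : 0 < n default) :
    (torusGraph n).HasBalancedDecomp (n default) := by
  have : NeZero (n default) := ⟨hn.ne'⟩
  let v (k : ℕ) (i : κ) : ZMod (n i) := k
  have hv {k k' : ℕ} (hk : k < n default) (hk' : k' < n default) (h : v k = v k') : k = k' :=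
    ((ZMod.natCast_eq_natCast_iff _ _ _).1 (congrFun h default)).eq_of_lt_of_lt hk hk'
  have hv' (w : ∀ i, ZMod (n i)) : ∃ k < n default, w = v k := by
    refine ⟨(w default).val, ZMod.val_lt _, funext fun i => ?_⟩
    obtain rfl := Unique.eq_default i
    exact (ZMod.natCast_zmod_val _).symm
  have hclosed : v (n default) = v 0 := funext fun i => by
    obtain rfl := Unique.eq_default i
    simp only [v, ZMod.natCast_self, Nat.cast_zero]
  let l := (List.range (n default)).map fun k => ((v k, (default : κ)), true)
  have hnodup : (l.map Prod.fst).Nodup := by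
    rw [List.map_map]
    exact List.nodup_range.map_on fun k hk k' hk' h =>
      hv (List.mem_range.1 hk) (List.mem_range.1 hk') (congrArg Prod.fst h)
  refine ⟨Unit, inferInstance, fun _ => l, ⟨fun _ => ⟨v 0, ?_⟩, fun _ => ?_, fun e => ?_⟩,
    fun _ i => ?_⟩
  · have hwalk := isWalk_flatMap_range (G := torusGraph n) v
      (fun k => [((v k, default), true)]) (n default) fun k _ => ⟨rfl, funext fun i => by
        obtain rfl := Unique.eq_default i
        simp [torusGraph, v]⟩
    rwa [hclosed, ← List.map_eq_flatMap] at hwalk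
  · rw [List.map_map]
    exact List.nodup_range.map_on fun k hk k' hk' h =>
      hv (List.mem_range.1 hk) (List.mem_range.1 hk') h
  · obtain ⟨k, hk, he⟩ := hv' e.1
    have hmem : e ∈ l.map Prod.fst := by
      rw [List.map_map]
      exact List.mem_map.2 ⟨k, List.mem_range.2 hk, Prod.ext he.symm (Subsingleton.elim _ _)⟩
    simp only [Fintype.sum_unique, countP_eq_ite_mem_of_nodup_map hnodup, hmem, if_true]
  · simp only [l, List.countP_map, Function.comp_def, Subsingleton.elim _ i, decide_true,
      List.countP_true, List.length_range]

theorem hasBalancedDecomp_torusGraph {m : ℕ} (n : Fin (m + 1) → ℕ) (c : Fin m → ℕ)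
    (h4 : 4 ∣ n 0) (hn : 0 < n 0) (hn' : ∀ k : Fin m, 1 < n k.succ)
    (hc : ∀ k, 2 * c k ∣ n k.succ) (hc' : ∀ k, c k = 1 ∨ Even (c k) ∨ 2 * c k = n k.succ) :
    (torusGraph n).HasBalancedDecomp (n 0 * ∏ k, c k) := by
  induction m with
  | zero =>
    have h : (torusGraph n).HasBalancedDecomp (n 0) :=
      hasBalancedDecomp_torusGraph_unique (κ := Fin 1) n hn
    simpa using h
  | succ m ih =>
    have hn_ne : ∀ i, NeZero (n i) := Fin.cases ⟨hn.ne'⟩ fun k => ⟨(hn' k).ne_bot⟩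
    have hc_pos (k : Fin (m + 1)) : 0 < c k :=
      Nat.pos_of_mul_pos_left (Nat.pos_of_dvd_of_pos (hc k) (hn' k).pos)
    have ih := ih (fun i => n i.castSucc) (fun k => c k.castSucc) h4 hn
      (fun k => hn' k.castSucc) (fun k => hc k.castSucc) fun k => hc' k.castSucc
    have hcyl := ih.cylinder (by simpa using isDiregular_torusGraph fun i => n (Fin.castSucc i))
      (hn' (Fin.last m)) (h4.mul_right _)
      (Nat.mul_pos hn (Finset.prod_pos fun k _ => hc_pos _))
      (hasColumnDecomp (hn' _) (hc _) (hc' _))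
    rw [Fin.prod_univ_castSucc, ← mul_assoc, mul_comm _ (c (Fin.last m))]
    exact (hcyl.torusGraph_option (n' := fun o => n (finSuccEquivLast.symm o)) (by simp)
      (by simp)).torusGraph_reindex finSuccEquivLast.symm fun _ => rfl

end Torus

end ColoredGraph

/-- The subgraph formed by the edges in `F` and their ends. -/
def edgeSubgraph {α β : Type*} (G : Graph α β) (F : Set β) : Graph α β where
  vertexSet := {x | ∃ e ∈ F, G.Inc e x}
  IsLink e x y := e ∈ F ∧ G.IsLink e x y
  isLink_symm := fun _ _ => ⟨fun _ _ h => ⟨h.1, h.2.symm⟩⟩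
  eq_or_eq_of_isLink_of_isLink := fun _ _ _ _ _ h h' =>
    G.eq_or_eq_of_isLink_of_isLink h.2 h'.2
  left_mem_of_isLink := fun e _ y h => ⟨e, h.1, y, h.2⟩

theorem edgeSubgraph_le {α β : Type*} (G : Graph α β) (F : Set β) : edgeSubgraph G F ≤ G :=
  ⟨fun _ ⟨_, _, _, h⟩ => h.left_mem, fun _ _ _ h => h.2⟩

theorem edgeSet_edgeSubgraph {α β : Type*} (G : Graph α β) (F : Set β) :
    E(edgeSubgraph G F) = E(G) ∩ F := by
  ext e
  simp only [Graph.edge_mem_iff_exists_isLink, edgeSubgraph, Set.mem_inter_iff, exists_and_left]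
  exact and_comm

theorem IsDecomposition.comp_equiv {α β κ κ' : Type*} {G : Graph α β} {H : κ → Graph α β}
    (h : IsDecomposition G H) (f : κ' ≃ κ) : IsDecomposition G (H ∘ f) where
  le j := h.le (f j)
  vertexSet_eq := h.vertexSet_eq.trans (f.surjective.iUnion_comp fun j => V(H j)).symm
  edgeSet_eq := h.edgeSet_eq.trans (f.surjective.iUnion_comp fun j => E(H j)).symm
  disjoint _ _ hne := h.disjoint _ _ (f.injective.ne hne)

theorem injective_getElem_val {α β : Type*} {g : α → β} {l : List α} [NeZero l.length]
    (hg : (l.map g).Nodup) :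
    Function.Injective fun k : ZMod l.length => g (l[k.val]'k.val_lt) := fun k k' hk =>
  ZMod.val_injective _ <| (hg.getElem_inj_iff (hi := by simpa using k.val_lt)
    (hj := by simpa using k'.val_lt)).1 (by simpa only [List.getElem_map] using hk)

namespace ColoredGraph

variable {V E ι : Type*} {G : ColoredGraph V E ι} {l : List (E × Bool)} {u : V}

/-- The underlying undirected uncoloured multigraph. -/
def toGraph (G : ColoredGraph V E ι) : Graph V E where
  vertexSet := Set.univ
  IsLink e x y := (x = G.src e ∧ y = G.tgt e) ∨ (y = G.src e ∧ x = G.tgt e)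
  edgeSet := Set.univ
  isLink_symm := fun _ _ => ⟨fun _ _ h => h.symm⟩
  eq_or_eq_of_isLink_of_isLink := by
    rintro e x y v w (⟨rfl, rfl⟩ | ⟨rfl, rfl⟩) (⟨rfl, rfl⟩ | ⟨rfl, rfl⟩) <;> simp
  edge_mem_iff_exists_isLink := fun e =>
    ⟨fun _ => ⟨_, _, Or.inl ⟨rfl, rfl⟩⟩, fun _ => Set.mem_univ e⟩
  left_mem_of_isLink := fun _ _ _ _ => Set.mem_univ _

theorem toGraph_isLink (a : E × Bool) : G.toGraph.IsLink a.1 (G.tail a) (G.head a) := by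
  rcases a with ⟨e, _ | _⟩
  exacts [.inr ⟨rfl, rfl⟩, .inl ⟨rfl, rfl⟩]

/-- The edges and vertices passed by the walk `l`. -/
def walkSubgraph (G : ColoredGraph V E ι) (l : List (E × Bool)) : Graph V E :=
  edgeSubgraph G.toGraph {e | e ∈ l.map Prod.fst}

theorem edgeSet_walkSubgraph (l : List (E × Bool)) :
    E(G.walkSubgraph l) = {e | e ∈ l.map Prod.fst} :=
  (edgeSet_edgeSubgraph _ _).trans (Set.univ_inter _)

theorem IsWalk.map_head_eq_rotate (h : G.IsWalk u l u) :
    l.map G.head = (l.map G.tail).rotate 1 := by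
  have hl := h.map_tail_append
  rcases l with _ | ⟨a, l⟩
  · rfl
  · obtain ⟨hu, hl⟩ := List.cons.inj hl
    rw [List.map_cons (f := G.tail), List.rotate_cons_succ, List.rotate_zero, hu]
    exact hl.symm

theorem IsWalk.head_getElem (h : G.IsWalk u l u) (k : ℕ) (hk : k < l.length) :
    G.head l[k] = G.tail (l[(k + 1) % l.length]'(Nat.mod_lt _ (k.zero_le.trans_lt hk))) := by
  have hrot := List.getElem_of_eq h.map_head_eq_rotate (i := k) (by simpa using hk)
  simpa only [List.getElem_map, List.getElem_rotate, List.length_map] using hrot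

theorem IsWalk.isCycleOfLength_walkSubgraph (h : G.IsWalk u l u) (hv : (l.map G.tail).Nodup)
    (he : (l.map Prod.fst).Nodup) (hl : 2 ≤ l.length) :
    IsCycleOfLength (G.walkSubgraph l) l.length := by
  have : NeZero l.length := ⟨by omega⟩
  have : Fact (1 < l.length) := ⟨hl⟩
  let dart (k : ZMod l.length) : E × Bool := l[k.val]'k.val_lt
  have hmem (k : ZMod l.length) : (dart k).1 ∈ l.map Prod.fst :=
    List.mem_map_of_mem (List.getElem_mem _)
  have hsurj : ∀ e ∈ l.map Prod.fst, ∃ k, (dart k).1 = e := by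
    intro e he
    obtain ⟨a, ha, rfl⟩ := List.mem_map.1 he
    obtain ⟨k, hk, rfl⟩ := List.getElem_of_mem ha
    exact ⟨k, by simp only [dart, ZMod.val_cast_of_lt hk]⟩
  have hlink (k : ZMod l.length) :
      G.toGraph.IsLink (dart k).1 (G.tail (dart k)) (G.tail (dart (k + 1))) := by
    have hhead := h.head_getElem k.val k.val_lt
    simp only [dart, ZMod.val_add, ZMod.val_one, ← hhead]
    exact toGraph_isLink _
  refine ⟨hl, fun k => G.tail (dart k), fun k => (dart k).1, injective_getElem_val hv,
    injective_getElem_val he, Set.Subset.antisymm ?_ ?_, Set.Subset.antisymm ?_ ?_,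
    fun k => ⟨hmem k, hlink k⟩⟩
  · rintro x ⟨e, he, y, hxy⟩
    obtain ⟨k, rfl⟩ := hsurj e he
    rcases G.toGraph.eq_or_eq_of_isLink_of_isLink hxy (hlink k) with rfl | rfl
    exacts [⟨k, rfl⟩, ⟨k + 1, rfl⟩]
  · rintro _ ⟨k, rfl⟩
    exact ⟨_, hmem k, _, hlink k⟩
  · exact (edgeSet_walkSubgraph l).trans_subset hsurj
  · rw [edgeSet_walkSubgraph]
    rintro _ ⟨k, rfl⟩
    exact hmem k

theorem ncard_edgeSet_walkSubgraph_color [DecidableEq ι] (he : (l.map Prod.fst).Nodup) (i : ι) :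
    {e ∈ E(G.walkSubgraph l) | G.color e = i}.ncard = l.countP (G.color ·.1 = i) := by
  classical
  have hcoe : {e ∈ E(G.walkSubgraph l) | G.color e = i} =
      (((l.map Prod.fst).filter (G.color · = i)).toFinset : Set E) := by
    ext e
    simp [edgeSet_walkSubgraph]
  rw [hcoe, Set.ncard_coe_finset, List.toFinset_card_of_nodup (he.filter _),
    ← List.countP_eq_length_filter, List.countP_map]
  rfl

namespace IsCycleDecomp

variable {J : Type*} [Fintype J] [DecidableEq E] {l : J → List (E × Bool)}

theorem exists_mem (h : G.IsCycleDecomp l) (e : E) : ∃ j, e ∈ (l j).map Prod.fst := by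
  by_contra! hne
  have hzero (j : J) : (l j).countP (·.1 = e) = 0 := by
    rw [countP_eq_ite_mem_of_nodup_map (h.nodup_edges j), if_neg (hne j)]
  simpa only [hzero, Finset.sum_const_zero, zero_ne_one] using h.cover e

theorem eq_of_mem (h : G.IsCycleDecomp l) {e : E} {j j' : J} (hj : e ∈ (l j).map Prod.fst)
    (hj' : e ∈ (l j').map Prod.fst) : j = j' := by
  by_contra hne
  have hle := Finset.add_le_sum (f := fun j => (l j).countP (·.1 = e)) (fun _ _ => Nat.zero_le _)
    (Finset.mem_univ j) (Finset.mem_univ j') hne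
  rw [h.cover e, countP_eq_ite_mem_of_nodup_map (h.nodup_edges j), if_pos hj,
    countP_eq_ite_mem_of_nodup_map (h.nodup_edges j'), if_pos hj'] at hle
  omega

theorem isDecomposition (h : G.IsCycleDecomp l) (hsrc : G.src.Surjective) :
    IsDecomposition G.toGraph fun j => G.walkSubgraph (l j) where
  le _ := edgeSubgraph_le _ _
  vertexSet_eq := by
    refine (Set.eq_univ_of_forall fun v => ?_).symm
    obtain ⟨e, rfl⟩ := hsrc v
    obtain ⟨j, hj⟩ := h.exists_mem e
    exact Set.mem_iUnion.2 ⟨j, e, hj, _, toGraph_isLink (e, true)⟩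
  edgeSet_eq := by
    simp only [edgeSet_walkSubgraph]
    exact (Set.eq_univ_of_forall fun e => Set.mem_iUnion.2 (h.exists_mem e)).symm
  disjoint j j' hne := by
    simp only [edgeSet_walkSubgraph]
    exact Set.disjoint_left.2 fun e hj hj' => hne (h.eq_of_mem hj hj')

end IsCycleDecomp

theorem HasBalancedDecomp.exists_isDecomposition [Fintype E] [DecidableEq E] [Fintype ι]
    [DecidableEq ι] {R K : ℕ} (h : G.HasBalancedDecomp R) (hsrc : G.src.Surjective)
    (hR : 2 ≤ Fintype.card ι * R) (hK : K * (Fintype.card ι * R) = Fintype.card E) :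
    ∃ H : Fin K → Graph V E, IsDecomposition G.toGraph H ∧
      ∀ j, IsCycleOfLength (H j) (Fintype.card ι * R) ∧
        ∀ i, {e ∈ E(H j) | G.color e = i}.ncard = R := by
  obtain ⟨J, _, l, hl, hcolor⟩ := h
  have hlen (j : J) : (l j).length = Fintype.card ι * R := length_eq_card_mul (hcolor j)
  have hcard : Fintype.card J = K := by
    have hsum := hl.sum_sum_map fun _ => 1
    simp only [List.map_const', List.sum_replicate, hlen, Finset.sum_const, Finset.card_univ,
      smul_eq_mul, mul_one, ← hK] at hsum
    exact Nat.eq_of_mul_eq_mul_right (by omega) hsum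
  let f : Fin K ≃ J := (Fintype.equivFinOfCardEq hcard).symm
  refine ⟨_, (hl.isDecomposition hsrc).comp_equiv f, fun j => ⟨?_, fun i => ?_⟩⟩
  · obtain ⟨u, hu⟩ := hl.closed (f j)
    exact hlen (f j) ▸ hu.isCycleOfLength_walkSubgraph (hl.nodup _) (hl.nodup_edges _)
      (hR.trans_eq (hlen _).symm)
  · exact (ncard_edgeSet_walkSubgraph_color (hl.nodup_edges _) i).trans (hcolor _ i)

end ColoredGraph

theorem toGraph_torusGraph {d : ℕ} (n : Fin d → ℕ) :
    (ColoredGraph.torusGraph n).toGraph = torus n := rfl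

theorem exists_isDecomposition_torus {d R K : ℕ} {n : Fin d → ℕ} (hn : ∀ i, 0 < n i)
    (h : (ColoredGraph.torusGraph n).HasBalancedDecomp R) (hR : 2 ≤ d * R)
    (hK : K * R = ∏ i, n i) :
    ∃ H : Fin K → Graph (∀ i, ZMod (n i)) ((∀ i, ZMod (n i)) × Fin d),
      IsDecomposition (torus n) H ∧ ∀ j, IsCycleOfLength (H j) (d * R) ∧
        ∀ i, {e ∈ E(H j) | e.2 = i}.ncard = R := by
  have hne : ∀ i, NeZero (n i) := fun i => ⟨(hn i).ne'⟩
  have hd : 0 < d := Nat.pos_of_mul_pos_right (two_pos.trans_le hR)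
  have hcard : K * (d * R) = Fintype.card ((∀ i, ZMod (n i)) × Fin d) := by
    simp only [Fintype.card_prod, Fintype.card_pi, ZMod.card, Fintype.card_fin, ← hK]
    ring
  have hsrc : (ColoredGraph.torusGraph n).src.Surjective := fun v => ⟨(v, ⟨0, hd⟩), rfl⟩
  have hdec := h.exists_isDecomposition (K := K) hsrc
  rw [Fintype.card_fin, toGraph_torusGraph] at hdec
  exact hdec hR hcard

section FactorLength

variable {m : ℕ} {z : ℕ → ℕ}

theorem factorLength_swap (z : ℕ → ℕ) (i : Fin (m + 2)) :
    factorLength z (m + 2) (Equiv.swap 0 1 i) =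
      (Fin.cons (z (m + 2)) fun k : Fin (m + 1) => z (k + 1) : Fin (m + 2) → ℕ) i := by
  refine Fin.cases ?_ (Fin.cases ?_ fun k => ?_) i
  · simp [factorLength]
  · simp [factorLength]
  · have hone : k.succ.succ ≠ 1 := fun h => Fin.succ_ne_zero k (Fin.succ_injective _ h)
    rw [Equiv.swap_apply_of_ne_of_ne (Fin.succ_ne_zero _) hone]
    simp [factorLength]

theorem prod_factorLength (m : ℕ) (z : ℕ → ℕ) :
    ∏ i, factorLength z (m + 2) i = z (m + 2) * ∏ k ∈ Finset.range (m + 1), z (k + 1) := by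
  rw [← Equiv.prod_comp (Equiv.swap 0 1)]
  simp only [factorLength_swap, Fin.prod_cons, Finset.prod_range]

theorem factorLength_pos (hz : ∀ i, 1 ≤ i → i ≤ m + 2 → 0 < z i) (i : Fin (m + 2)) :
    0 < factorLength z (m + 2) i := by
  unfold factorLength
  split_ifs
  exacts [hz _ le_rfl (by omega), hz _ (by omega) le_rfl, hz _ (by omega) i.2.le]

theorem hasBalancedDecomp_factorLength {c : ℕ → ℕ} (hz : ∀ i, 1 ≤ i → i ≤ m + 2 → 0 < z i)
    (h4 : 4 ∣ z (m + 2)) (hc : ∀ k ≤ m, 2 * c k ∣ z (k + 1))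
    (hc' : ∀ k ≤ m, c k = 1 ∨ Even (c k) ∨ 2 * c k = z (k + 1)) :
    (ColoredGraph.torusGraph (factorLength z (m + 2))).HasBalancedDecomp
      (z (m + 2) * ∏ k ∈ Finset.range (m + 1), c k) := by
  have hz' (k : Fin (m + 1)) : 1 < z (k + 1) :=
    Nat.le_of_dvd (hz _ (by omega) (by omega)) ((Dvd.intro _ rfl).trans (hc k (by omega)))
  rw [Finset.prod_range]
  exact (ColoredGraph.hasBalancedDecomp_torusGraph
    (Fin.cons (z (m + 2)) fun k : Fin (m + 1) => z (k + 1)) (fun k => c k) h4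
    (hz _ (by omega) le_rfl) hz' (fun k => hc k (by omega))
    fun k => hc' k (by omega)).torusGraph_reindex (Equiv.swap 0 1) (factorLength_swap z)

theorem hasBalancedDecomp_factorLength_half {A : ℕ → ℕ} (hz : ∀ i, 1 ≤ i → i ≤ m + 2 → 0 < z i)
    (h4 : 4 ∣ z (m + 2)) (hA3 : A 3 ∣ z 1)
    (hA : ∀ k, 3 ≤ k → k ≤ m + 2 → 2 * A (k + 1) ∣ z (k - 1))
    (hA3' : A 3 = 2 ∨ 4 ∣ A 3 ∨ Even (z 1) ∧ A 3 = z 1)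
    (hA' : ∀ k, 3 ≤ k → k ≤ m + 2 →
      A (k + 1) = 1 ∨ Even (A (k + 1)) ∨ 2 * A (k + 1) = z (k - 1)) :
    (ColoredGraph.torusGraph (factorLength z (m + 2))).HasBalancedDecomp
      (z (m + 2) / 2 * ∏ k ∈ Finset.range (m + 1), A (k + 3)) := by
  obtain ⟨a, ha⟩ : 2 ∣ A 3 := by
    rcases hA3' with h | h | ⟨h, h'⟩
    exacts [h ▸ dvd_rfl, (by norm_num : 2 ∣ 4).trans h, h' ▸ h.two_dvd]
  let c (k : ℕ) : ℕ := Nat.casesOn k a fun k => A (k + 4)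
  have hprod : ∏ k ∈ Finset.range (m + 1), A (k + 3) = 2 * ∏ k ∈ Finset.range (m + 1), c k := by
    rw [Finset.prod_range_succ', Finset.prod_range_succ', zero_add, ha]
    exact mul_left_comm _ _ _
  rw [hprod, ← mul_assoc, Nat.div_mul_cancel ((by norm_num : 2 ∣ 4).trans h4)]
  refine hasBalancedDecomp_factorLength hz h4 ?_ ?_
  · rintro (_ | k) hk
    exacts [ha ▸ hA3, hA (k + 3) (by omega) (by omega)]
  · rintro (_ | k) hk
    · change a = 1 ∨ Even a ∨ 2 * a = z 1
      rw [even_iff_two_dvd]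
      omega
    · exact hA' (k + 3) (by omega) (by omega)

end FactorLength

section Exponents

variable (z b : ℕ → ℕ) (d : ℕ)

theorem eta_eq_zero_or_one (y c : ℕ) : eta y c = 0 ∨ eta y c = 1 := by
  unfold eta
  split_ifs <;> simp

theorem A_three_eq : A z b d 3 = z 1 ∨ A z b d 3 = 2 * (b 1 + 1) := by
  have h : A₂ z b d = 0 ∨ A₂ z b d = 1 := eta_eq_zero_or_one _ _
  rcases h with h | h <;> simp [A, h]

theorem A_add_four_eq (k : ℕ) :
    A z b d (k + 4) = 1 ∨ A z b d (k + 4) = b (k + 2) + 1 ∨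
      A z b d (k + 4) = z (k + 2) / 2 := by
  have h : etaAlpha z b d (k + 2) = 0 ∨ etaAlpha z b d (k + 2) = 1 := eta_eq_zero_or_one _ _
  have h' : etaAlpha z b d (k + 3) = 0 ∨ etaAlpha z b d (k + 3) = 1 := eta_eq_zero_or_one _ _
  rcases h with h | h <;> rcases h' with h' | h' <;> simp [A, h, h']

variable {z b d}

theorem A_three_cases (hz : Even (z 1)) (hb : Odd (b 1) ∨ b 1 = 0) :
    A z b d 3 = 2 ∨ 4 ∣ A z b d 3 ∨ Even (z 1) ∧ A z b d 3 = z 1 := by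
  rcases A_three_eq z b d with h | h
  · exact .inr (.inr ⟨hz, h⟩)
  · rcases hb with ⟨q, hq⟩ | hb <;> omega

theorem A_succ_cases {k : ℕ} (hk : 3 ≤ k) (hz : Even (z (k - 1)))
    (hb : Odd (b (k - 1)) ∨ b (k - 1) = 0) :
    A z b d (k + 1) = 1 ∨ Even (A z b d (k + 1)) ∨ 2 * A z b d (k + 1) = z (k - 1) := by
  obtain ⟨k, rfl⟩ := Nat.exists_eq_add_of_le' hk
  rcases A_add_four_eq z b d k with h | h | h
  · exact .inl h
  · rcases hb with hb | hb
    · exact .inr (.inl (h ▸ hb.add_one))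
    · exact .inl (h.trans (congrArg (· + 1) hb))
  · exact .inr (.inr (h ▸ Nat.mul_div_cancel' hz.two_dvd))

end Exponents

end LockKey

theorem theorem5_general (d : ℕ) (hd : 2 ≤ d) (z A : ℕ → ℕ)
    (hz : ∀ i, 1 ≤ i → i ≤ d → 0 < z i)
    (h4 : 4 ∣ z d)
    (hA3 : A 3 ∣ z 1)
    (hA : ∀ k, 3 ≤ k → k ≤ d → 2 * A (k + 1) ∣ z (k - 1))
    (hA3' : A 3 = 2 ∨ 4 ∣ A 3 ∨ Even (z 1) ∧ A 3 = z 1)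
    (hA' : ∀ k, 3 ≤ k → k ≤ d → A (k + 1) = 1 ∨ Even (A (k + 1)) ∨ 2 * A (k + 1) = z (k - 1)) :
    ∃ H : Fin (2 * ∏ k ∈ Finset.range (d - 1), z (k + 1) / A (k + 3)) →
        Graph (∀ i, ZMod (LockKey.factorLength z d i))
          ((∀ i, ZMod (LockKey.factorLength z d i)) × Fin d),
      LockKey.IsDecomposition (LockKey.torus (LockKey.factorLength z d)) H ∧
      ∀ j,
        LockKey.IsCycleOfLength (H j) (d * z d / 2 * ∏ k ∈ Finset.range (d - 1), A (k + 3)) ∧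
        ∀ i : Fin d, {e ∈ (H j).edgeSet | e.2 = i}.ncard =
          z d / 2 * ∏ k ∈ Finset.range (d - 1), A (k + 3) := by
  obtain ⟨m, rfl⟩ := Nat.exists_eq_add_of_le' hd
  rw [show m + 2 - 1 = m + 1 from rfl, Nat.mul_div_assoc _ (by omega : 2 ∣ z (m + 2)), mul_assoc]
  have hdvd : ∀ k ∈ Finset.range (m + 1), A (k + 3) ∣ z (k + 1) := by
    rintro (_ | k) hk
    · exact hA3
    · rw [Finset.mem_range] at hk
      exact (Dvd.intro_left _ rfl).trans (hA (k + 3) (by omega) (by omega))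
  have hpos : 0 < ∏ k ∈ Finset.range (m + 1), A (k + 3) :=
    Finset.prod_pos fun k hk => Nat.pos_of_dvd_of_pos (hdvd k hk)
      (hz _ (by omega) (by rw [Finset.mem_range] at hk; omega))
  have h2 : 2 ≤ z (m + 2) / 2 := by
    have := hz (m + 2) (by omega) le_rfl
    omega
  refine LockKey.exists_isDecomposition_torus (LockKey.factorLength_pos hz)
    (LockKey.hasBalancedDecomp_factorLength_half hz h4 hA3 hA hA3' hA')
    (by nlinarith [Nat.mul_le_mul h2 hpos]) ?_
  rw [LockKey.prod_factorLength, ← Finset.prod_congr rfl fun k hk => Nat.div_mul_cancel (hdvd k hk),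
    Finset.prod_mul_distrib]
  obtain ⟨q, hq⟩ := h4
  rw [hq, show 4 * q / 2 = 2 * q by omega]
  ring

theorem theorem5 (d : ℕ) (hd : 2 ≤ d) (z b : ℕ → ℕ)
    (hz : ∀ i, 1 ≤ i → i ≤ d → 0 < z i ∧ Even (z i))
    (hb : ∀ i, 1 ≤ i → i ≤ d - 1 → Odd (b i) ∨ b i = 0)
    (h4 : 4 ∣ z d)
    (hA3 : LockKey.A z b d 3 ∣ z 1)
    (hA : ∀ k, 3 ≤ k → k ≤ d → 2 * LockKey.A z b d (k + 1) ∣ z (k - 1)) :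
    ∃ H : Fin (2 * ∏ k ∈ Finset.range (d - 1), z (k + 1) / LockKey.A z b d (k + 3)) →
        Graph (∀ i, ZMod (LockKey.factorLength z d i))
          ((∀ i, ZMod (LockKey.factorLength z d i)) × Fin d),
      LockKey.IsDecomposition (LockKey.torus (LockKey.factorLength z d)) H ∧
      ∀ j,
        LockKey.IsCycleOfLength (H j)
          (d * z d / 2 * ∏ k ∈ Finset.range (d - 1), LockKey.A z b d (k + 3)) ∧
        ∀ i : Fin d, {e ∈ (H j).edgeSet | e.2 = i}.ncard =
          z d / 2 * ∏ k ∈ Finset.range (d - 1), LockKey.A z b d (k + 3) :=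
  theorem5_general d hd z (LockKey.A z b d) (fun i h h' => (hz i h h').1) h4 hA3 hA
    (LockKey.A_three_cases (hz 1 le_rfl (by omega)).2 (hb 1 le_rfl (by omega)))
    fun k h h' => LockKey.A_succ_cases h (hz _ (by omega) (by omega)).2 (hb _ (by omega) (by omega))
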